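/- Let $n\ge 1$ and let $u=(u^1,\dots,u^n)$ be the standard coordinates on $\mathbb{R}^n$. Let $N$ be the constant operator field whose matrix has ones right above the diagonal ($N^i_{i+1}=1$) and zeros elsewhere, and let $U$ be the operator field whose matrix is the upper triangular Toeplitz matrix $$U^i_j=u^{\,n-(j-i)}\ \text{ for } i\le j,\qquad U^i_j=0\ \text{ for } i>j ,$$ so that $u^n$ stands on the diagonal and $u^1$ in the upper right corner. For a smooth function $h$ of one variable let $h(U)$ be the upper triangular Toeplitz matrix with entries $h(U)^i_j=h_{n-(j-i)}(u)$ for $i\le j$ and $0$ for $i>j$, where $h_n,h_{n-1},\dots,h_1$ are the Taylor coefficients in $$h\big(u^n+\lambda u^{n-1}+\dots+\lambda^{n-1}u^1\big)= h_n+\lambda h_{n-1}+\dots+\lambda^{n-1}h_1+O(\lambda^n),\qquad \lambda\to 0 .$$ Let $L$ be a smooth operator field (field of endomorphisms of the tangent spaces) on an open set $V\subseteq\mathbb{R}^n$. A smooth operator field $M$ on $V$ is a symmetry of $L$ on $V$ if $LM=ML$ and, for all smooth vector fields $\xi$ on $V$, $$\langle L,M\rangle(\xi,\xi)=M[L\xi,\xi]+L[\xi,M\xi]-[L\xi,M\xi]-LM[\xi,\xi]=0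 .$$ A smooth $1$-form $\theta$ on $V$ is a conservation law of $L$ on $V$ if $\mathrm{d}\theta=0$ and $\mathrm{d}(L^*\theta)=0$, where $(L^*\theta)(\xi)=\theta(L\xi)$. Then the following statements hold. 1. On every open set $V\subseteq\mathbb{R}^n$, the operator fields $U$ and $N$ have the same symmetries. 2. If $f_1,\dots,f_n$ are smooth functions on an open neighbourhood $I$ of $0\in\mathbb{R}$, then $$M=f_1(U)N^{n-1}+f_2(U)N^{n-2}+\dots+f_n(U)$$ is a symmetry of $U$ (hence of $N$) on $\{u : u^n\in I\}$. Conversely, every symmetry of $U$ (equivalently, of $N$) on an open neighbourhood of $0\in\mathbb{R}^n$ has this form on some smaller neighbourhood of $0$, for suitable $f_1,\dots,f_n$ smooth in a neighbourhood of $0\in\mathbb{R}$; the germs of $f_1,\dots,f_n$ at $0$ are uniquely determined by the germ of $M$ at $0$. 3. On every open set $V\subseteq\mathbb{R}^n$, the operator fields $U$ and $N$ have the same conservation laws. 4. If $M$ is as in item 2 with $f_1,\dots,f_n$ smooth on an open neighbourhood $I$ of $0$, and $f=M^1_n$ is its entry in the upper right corner, then $\mathrm{d}f$ is a conservation law of $U$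 (hence of $N$) on $\{u : u^n\in I\}$. Conversely, every conservation law of $U$ (equivalently, of $N$) on an open neighbourhood of $0\in\mathbb{R}^n$ coincides with such a $\mathrm{d}f$ on some smaller neighbourhood of $0$. -/

import Mathlib

open Set Filter Topology
open scoped ContDiff Matrix

noncomputable section

namespace ToeplitzJordan

/-- Points `(u¹, …, uⁿ)` of the coordinate space; `uᵏ` is the coordinate of index `k - 1`. -/
abbrev Pt (n : ℕ) : Type := Fin n → ℝ

/-- Fields of endomorphisms, given by their matrices `L^i_j` in the coordinates `u¹, …, uⁿ`. -/
abbrev OpField (n : ℕ) : Type := Pt n → Matrix (Fin n) (Fin n) ℝ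

/-- Differential 1-forms. -/
abbrev OneForm (n : ℕ) : Type := Pt n → (Pt n →L[ℝ] ℝ)

variable {n : ℕ}

/-- The vector field `L ξ`. -/
def OpField.app (L : OpField n) (ξ : Pt n → Pt n) : Pt n → Pt n :=
  fun u => L u *ᵥ ξ u

/-- The 1-form `L^* θ`, that is `(L^* θ)(v) = θ (L v)`. -/
def OpField.pull (L : OpField n) (θ : OneForm n) : OneForm n :=
  fun u => (θ u).comp (LinearMap.toContinuousLinearMap (L u).mulVecLin)

/-- All matrix entries of the operator field are smooth functions on `V`. -/
def OpField.SmoothOn (L : OpField n) (V : Set (Pt n)) : Prop :=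
  ∀ i j, ContDiffOn ℝ ∞ (fun u => L u i j) V

/-- `⟨L, M⟩(ξ, η) = M[Lξ, η] + L[ξ, Mη] - [Lξ, Mη] - LM[ξ, η]`. -/
def nijBracket (L M : OpField n) (ξ η : Pt n → Pt n) : Pt n → Pt n :=
  fun u =>
    M u *ᵥ VectorField.lieBracket ℝ (L.app ξ) η u
      + L u *ᵥ VectorField.lieBracket ℝ ξ (M.app η) u
      - VectorField.lieBracket ℝ (L.app ξ) (M.app η) u
      - (L u * M u) *ᵥ VectorField.lieBracket ℝ ξ η u

/-- `M` is a (smooth) symmetry of `L` on the open set `V`. -/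
structure IsSymmetryOn (V : Set (Pt n)) (L M : OpField n) : Prop where
  smooth : M.SmoothOn V
  commute : ∀ u ∈ V, L u * M u = M u * L u
  bracket_self : ∀ ξ : Pt n → Pt n, ContDiffOn ℝ ∞ ξ V →
    ∀ u ∈ V, nijBracket L M ξ ξ u = 0

/-- The 1-form `θ` is closed on the open set `V`:
`dθ(v, w) = (D_v θ)(w) - (D_w θ)(v)` vanishes there. -/
def IsClosedFormOn (V : Set (Pt n)) (θ : OneForm n) : Prop :=
  ∀ u ∈ V, ∀ v w : Pt n, fderiv ℝ θ u v w - fderiv ℝ θ u w v = 0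

/-- The (smooth) 1-form `θ` is a conservation law of `L` on the open set `V`:
both `θ` and `L^* θ` are closed there. -/
structure IsConservationLawOn (V : Set (Pt n)) (L : OpField n) (θ : OneForm n) : Prop where
  smooth : ContDiffOn ℝ ∞ θ V
  closed : IsClosedFormOn V θ
  pull_closed : IsClosedFormOn V (L.pull θ)

/-- The nilpotent Jordan block: ones right above the diagonal, zeros elsewhere. -/
def nilBlock (n : ℕ) : Matrix (Fin n) (Fin n) ℝ :=
  Matrix.of fun i j => if (j : ℕ) = (i : ℕ) + 1 then 1 else 0

/-- The nilpotent Jordan block as a constant operator field `N`. -/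
def fieldN (n : ℕ) : OpField n := fun _ => nilBlock n

/-- The upper triangular Toeplitz operator field `U`, with `uⁿ` on the diagonal, `uⁿ⁻¹` right
above it, …, and `u¹` in the upper right corner. -/
def fieldU (n : ℕ) : OpField n := fun u =>
  Matrix.of fun i j =>
    if i ≤ j then u (Fin.rev ⟨(j : ℕ) - (i : ℕ), lt_of_le_of_lt (Nat.sub_le _ _) j.isLt⟩) else 0

/-- The polynomial `uⁿ + t uⁿ⁻¹ + … + tⁿ⁻¹ u¹`. -/
def curve (u : Pt n) (t : ℝ) : ℝ := ∑ j : Fin n, t ^ (j : ℕ) * u (Fin.rev j)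

/-- The coefficient of `t ^ k` in the Taylor expansion of `h (uⁿ + t uⁿ⁻¹ + … + tⁿ⁻¹ u¹)`
at `t = 0`. -/
def taylorCoeff (h : ℝ → ℝ) (u : Pt n) (k : ℕ) : ℝ :=
  iteratedDeriv k (fun t => h (curve u t)) 0 / (k.factorial : ℝ)

/-- The operator field `h(U)`: the upper triangular Toeplitz matrix whose `k`-th superdiagonal
is the `k`-th Taylor coefficient of `h (uⁿ + t uⁿ⁻¹ + … + tⁿ⁻¹ u¹)` at `t = 0`. -/
def funU (n : ℕ) (h : ℝ → ℝ) : OpField n := fun u =>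
  Matrix.of fun i j => if i ≤ j then taylorCoeff h u ((j : ℕ) - (i : ℕ)) else 0

/-- `f₁(U) Nⁿ⁻¹ + f₂(U) Nⁿ⁻² + … + fₙ(U)`; the function `fₖ` has index `k - 1`. -/
def symField (f : Fin n → ℝ → ℝ) : OpField n := fun u =>
  ∑ i : Fin n, funU n (f i) u * nilBlock n ^ (n - 1 - (i : ℕ))

/-- The entry in the upper right corner of `f₁(U) Nⁿ⁻¹ + f₂(U) Nⁿ⁻² + … + fₙ(U)`. -/
def cornerFun (hn : 0 < n) (f : Fin n → ℝ → ℝ) : Pt n → ℝ := fun u =>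
  symField f u ⟨0, hn⟩ ⟨n - 1, Nat.sub_lt hn Nat.one_pos⟩

/-- The points whose last coordinate `uⁿ` lies in `I`. -/
def slab (hn : 0 < n) (I : Set ℝ) : Set (Pt n) :=
  {u | u ⟨n - 1, Nat.sub_lt hn Nat.one_pos⟩ ∈ I}

end ToeplitzJordan

end

/-! The matrices commuting with `N` form the commutative algebra `ℝ[N]/(Nⁿ)`. The map `v ↦ fieldU n
v` identifies it with `ℝⁿ`: the product of `v` and `w` is `v·w = fieldU n v *ᵥ w`, and the unit is
`1 = unitPt n`. Everything reduces to smooth maps `m` whose derivative is linear over this algebra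
(`IsHoloOn`), an analogue of holomorphic functions.

A symmetry `M` of `N` is Toeplitz, so it is multiplication by `m = M 1`, and `⟨N, M⟩(ξ, ξ) = ξ·(N
dm(ξ) - dm(Nξ))`. Polarising with the unit shows that this vanishes for all `ξ` exactly when `m` is
holomorphic. A covector `θ` corresponds to a point `a` through the nondegenerate pairing `(a·w)₀`;
closedness of `θ` and `N^*θ` says again that `a` is holomorphic. For `U` the same computations give
commutation with `U` instead of `N`. Where `uⁿ⁻¹ ≠ 0` the matrix `U` generates the algebra, and
density and continuity do the rest.

A holomorphic map on a ball around the origin is determined by its restriction to the line `s·1`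
(`IsHoloOn.eq_zero_of_line`). Conversely the Taylor construction `h(U)` is holomorphic, and `symVec
f` restricts on that line to `(f₁(s), …, fₙ(s))`. This gives existence and uniqueness of the `fₖ`.
The differential of the corner entry corresponds to the derivative `dm(1)` of `m = symVec f`, so a
conservation law is integrated by integrating its restriction to the line. -/

noncomputable section

namespace ToeplitzJordan

variable {n : ℕ}

/-! ### The algebra of upper triangular Toeplitz matrices -/

/-- The last standard basis vector; it is the unit for the multiplication
`(v, w) ↦ fieldU n v *ᵥ w`. -/
def unitPt (n : ℕ) : Pt n := fun i => if (i : ℕ) + 1 = n then 1 else 0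

theorem nilBlock_apply (i j : Fin n) :
    nilBlock n i j = if (j : ℕ) = i + 1 then 1 else 0 := rfl

theorem nilBlock_pow_apply (k : ℕ) (i j : Fin n) :
    (nilBlock n ^ k) i j = if (j : ℕ) = i + k then 1 else 0 := by
  induction k generalizing i with
  | zero => simp [Matrix.one_apply, Fin.ext_iff, eq_comm]
  | succ k ih =>
    rw [pow_succ', Matrix.mul_apply]
    simp only [ih, nilBlock_apply, ite_mul, one_mul, zero_mul]
    by_cases h : (i : ℕ) + 1 < n
    · rw [Finset.sum_eq_single ⟨(i : ℕ) + 1, h⟩]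
      · simp only [if_true]
        grind
      · intro b _ hb
        rw [if_neg]
        exact fun h' => hb (Fin.ext h')
      · simp
    · rw [Finset.sum_eq_zero, if_neg (by omega)]
      intro b _
      rw [if_neg (by omega)]

theorem nilBlock_pow_eq_zero {k : ℕ} (hk : n ≤ k) : nilBlock n ^ k = 0 := by
  ext i j
  rw [nilBlock_pow_apply, if_neg (by omega), Matrix.zero_apply]

theorem nilBlock_pow_mulVec_unitPt (i : Fin n) :
    nilBlock n ^ (n - 1 - (i : ℕ)) *ᵥ unitPt n = Pi.single i 1 := by
  ext j
  simp only [Matrix.mulVec, dotProduct, nilBlock_pow_apply, unitPt, ite_mul, one_mul, zero_mul]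
  rw [Finset.sum_eq_single ⟨n - 1, by have := j.isLt; omega⟩]
  · simp only [Pi.single_apply, Fin.ext_iff]
    split_ifs <;> first | rfl | omega
  · intro b _ hb
    have : (b : ℕ) ≠ n - 1 := fun h => hb (Fin.ext h)
    split_ifs <;> first | rfl | omega
  · simp

theorem fieldU_eq_sum (v : Pt n) :
    fieldU n v = ∑ k : Fin n, v (Fin.rev k) • nilBlock n ^ (k : ℕ) := by
  ext i j
  rw [Matrix.sum_apply]
  simp only [Matrix.smul_apply, nilBlock_pow_apply, smul_eq_mul, mul_ite, mul_one, mul_zero,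
    fieldU, Matrix.of_apply]
  split_ifs with h
  · have h' : (i : ℕ) ≤ j := h
    rw [Finset.sum_eq_single ⟨(j : ℕ) - i, by omega⟩]
    · rw [if_pos]
      simp only
      omega
    · intro b _ hb
      have : (b : ℕ) ≠ j - i := fun h => hb (Fin.ext h)
      rw [if_neg (by omega)]
    · simp
  · have h' : ¬ (i : ℕ) ≤ j := h
    rw [Finset.sum_eq_zero]
    intro b _
    rw [if_neg (by omega)]

theorem fieldU_mulVec_unitPt (v : Pt n) : fieldU n v *ᵥ unitPt n = v := by
  rw [fieldU_eq_sum, Matrix.sum_mulVec]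
  ext i
  rw [Finset.sum_apply, ← Equiv.sum_comp Fin.revPerm]
  simp only [Fin.revPerm_apply, Fin.rev_rev, Matrix.smul_mulVec, Fin.val_rev, Pi.smul_apply,
    smul_eq_mul]
  have (k : Fin n) : n - ((k : ℕ) + 1) = n - 1 - k := by omega
  simp only [this, nilBlock_pow_mulVec_unitPt, Pi.single_apply]
  simp

theorem fieldU_add (v w : Pt n) : fieldU n (v + w) = fieldU n v + fieldU n w := by
  simp [fieldU_eq_sum, add_smul, Finset.sum_add_distrib]

theorem fieldU_smul (c : ℝ) (v : Pt n) : fieldU n (c • v) = c • fieldU n v := by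
  simp [fieldU_eq_sum, Finset.smul_sum, smul_smul]

theorem fieldU_mul_nilBlock (v : Pt n) :
    fieldU n v * nilBlock n = nilBlock n * fieldU n v := by
  rw [fieldU_eq_sum, Finset.sum_mul, Finset.mul_sum]
  refine Finset.sum_congr rfl fun k _ => ?_
  rw [smul_mul_assoc, mul_smul_comm, ← pow_succ, ← pow_succ']

theorem mul_fieldU_of_commute {T : Matrix (Fin n) (Fin n) ℝ}
    (h : T * nilBlock n = nilBlock n * T) (v : Pt n) : T * fieldU n v = fieldU n v * T := by
  have h' : Commute T (nilBlock n) := h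
  rw [fieldU_eq_sum]
  exact Commute.sum_right _ _ _ fun k _ => (h'.pow_right _).smul_right _

theorem fieldU_comm (v w : Pt n) : fieldU n v * fieldU n w = fieldU n w * fieldU n v :=
  mul_fieldU_of_commute (fieldU_mul_nilBlock v) w

theorem fieldU_mulVec_comm (v w : Pt n) : fieldU n v *ᵥ w = fieldU n w *ᵥ v := by
  conv_lhs => rw [← fieldU_mulVec_unitPt w]
  conv_rhs => rw [← fieldU_mulVec_unitPt v]
  rw [Matrix.mulVec_mulVec, Matrix.mulVec_mulVec, fieldU_comm]

/-- A linear map commuting with the Jordan block is the multiplication by the image of the unit. -/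
theorem map_eq_fieldU_of_commute {D : Pt n →ₗ[ℝ] Pt n}
    (h : ∀ v, D (nilBlock n *ᵥ v) = nilBlock n *ᵥ D v) (v : Pt n) :
    D v = fieldU n v *ᵥ D (unitPt n) := by
  have hp (k : ℕ) : ∀ w, D (nilBlock n ^ k *ᵥ w) = nilBlock n ^ k *ᵥ D w := by
    induction k with
    | zero => simp
    | succ k ih =>
      intro w
      rw [pow_succ, ← Matrix.mulVec_mulVec, ih, h, Matrix.mulVec_mulVec]
  conv_lhs => rw [← fieldU_mulVec_unitPt v]
  simp only [fieldU_eq_sum, Matrix.sum_mulVec, Matrix.smul_mulVec, map_sum, map_smul, hp]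

/-- `unitPt` is a cyclic vector of the Jordan block, so a commuting matrix is determined by its
value there. -/
theorem eq_fieldU_of_commute {T : Matrix (Fin n) (Fin n) ℝ}
    (h : nilBlock n * T = T * nilBlock n) : T = fieldU n (T *ᵥ unitPt n) := by
  refine Matrix.ext_of_mulVec_single fun i => ?_
  rw [fieldU_mulVec_comm]
  exact map_eq_fieldU_of_commute (D := T.mulVecLin) (fun v => by
    simp only [Matrix.mulVecLin_apply, Matrix.mulVec_mulVec, h]) _

theorem fieldU_mulVec (v w : Pt n) : fieldU n (fieldU n v *ᵥ w) = fieldU n v * fieldU n w := by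
  have h : nilBlock n * (fieldU n v * fieldU n w) = fieldU n v * fieldU n w * nilBlock n := by
    rw [← mul_assoc, ← fieldU_mul_nilBlock, mul_assoc, mul_assoc, fieldU_mul_nilBlock]
  rw [eq_fieldU_of_commute h, ← Matrix.mulVec_mulVec, fieldU_mulVec_unitPt]

/-! ### Points where `U` generates the algebra -/

/-- In an algebra, an element commuting with `c + a q(a)`, where `a` is nilpotent and `q(0) ≠ 0`,
commutes with `a`. -/
theorem commute_of_commute_add_mul_aeval {R : Type*} [Ring R] [Algebra ℝ R] {a T : R} {m : ℕ}
    (ha : a ^ m = 0) (c : ℝ) {q : Polynomial ℝ} (hq : q.coeff 0 ≠ 0)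
    (hT : Commute T (algebraMap ℝ R c + a * Polynomial.aeval a q)) : Commute T a := by
  have hx : Commute T (a * Polynomial.aeval a q) := by
    have := hT.sub_right (Algebra.commutes c T).symm
    rwa [add_sub_cancel_left] at this
  -- Descending induction on the exponent `j`, with `d` bounding `m - j`: the power `(a q(a))^j` is
  -- `q(0)^j a^j` plus higher powers of `a`, which already commute with `T`.
  have key : ∀ d j, 1 ≤ j → m ≤ j + d → Commute T (a ^ j) := by
    intro d
    induction d with
    | zero =>
      intro j _ hj
      rw [pow_eq_zero_of_le (by simpa using hj) ha]
      exact Commute.zero_right T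
    | succ d ih =>
      intro j hj hjd
      obtain ⟨r, hr⟩ : ∃ r, q ^ j = r * Polynomial.X + Polynomial.C ((q.coeff 0) ^ j) := by
        refine ⟨(q ^ j).divX, ?_⟩
        conv_lhs => rw [← Polynomial.divX_mul_X_add (q ^ j)]
        simp [Polynomial.coeff_zero_eq_eval_zero]
      have hca : Commute a (Polynomial.aeval a q) := by
        have := Polynomial.aeval_mul (x := a) (p := Polynomial.X) (q := q)
        rw [mul_comm, Polynomial.aeval_mul] at this
        simpa [Commute, SemiconjBy] using this.symm
      have h1 : (a * Polynomial.aeval a q) ^ j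
          = Polynomial.aeval a (r * Polynomial.X ^ (j + 1)) + (q.coeff 0) ^ j • a ^ j := by
        have h2 : a ^ j = Polynomial.aeval a (Polynomial.X ^ j : Polynomial ℝ) := by simp
        rw [hca.mul_pow, ← map_pow, hr, h2, ← map_mul, ← map_smul, ← map_add]
        congr 1
        rw [Polynomial.smul_eq_C_mul]
        ring
      have h3 : Commute T (Polynomial.aeval a (r * Polynomial.X ^ (j + 1))) := by
        rw [Polynomial.aeval_eq_sum_range]
        refine Commute.sum_right _ _ _ fun i _ => ?_
        rw [Polynomial.coeff_mul_X_pow']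
        split_ifs with h
        · exact (ih i (by omega) (by omega)).smul_right _
        · rw [zero_smul]
          exact Commute.zero_right T
      have h4 : Commute T ((q.coeff 0) ^ j • a ^ j) := by
        have := (hx.pow_right j).sub_right h3
        rwa [h1, add_sub_cancel_left] at this
      have h5 := h4.smul_right ((q.coeff 0) ^ j)⁻¹
      rwa [smul_smul, inv_mul_cancel₀ (pow_ne_zero _ hq), one_smul] at h5
  simpa using key m 1 le_rfl (by omega)

/-- The points `u` such that `U` generates at `u` the algebra of all Toeplitz matrices. -/
def genericPts (n : ℕ) : Set (Pt n) :=
  {u | ∀ T : Matrix (Fin n) (Fin n) ℝ,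
    T * fieldU n u = fieldU n u * T → T * nilBlock n = nilBlock n * T}

/-- Here `U = uⁿ + N q(N)` with `q(0) = uⁿ⁻¹`, the coordinate `u (Fin.rev 1)`. -/
theorem mem_genericPts (n : ℕ) (u : Pt (n + 2)) (hu : u (Fin.rev 1) ≠ 0) :
    u ∈ genericPts (n + 2) := by
  intro T hT
  let q : Polynomial ℝ :=
    ∑ k : Fin (n + 1), Polynomial.C (u (Fin.rev k.succ)) * Polynomial.X ^ (k : ℕ)
  refine commute_of_commute_add_mul_aeval (nilBlock_pow_eq_zero le_rfl) (u (Fin.rev 0)) (q := q)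
    ?_ ?_
  · simp only [q, Polynomial.finsetSum_coeff, Polynomial.coeff_C_mul, Polynomial.coeff_X_pow]
    rw [Finset.sum_eq_single 0]
    · simpa using hu
    · intro b _ hb
      rw [if_neg, mul_zero]
      exact fun h => hb (Fin.ext h.symm)
    · simp
  · have : fieldU (n + 2) u = algebraMap ℝ (Matrix (Fin (n + 2)) (Fin (n + 2)) ℝ) (u (Fin.rev 0))
        + nilBlock (n + 2) * Polynomial.aeval (nilBlock (n + 2)) q := by
      rw [fieldU_eq_sum, Fin.sum_univ_succ]
      simp only [q, map_sum, map_mul, Polynomial.aeval_C, map_pow, Polynomial.aeval_X,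
        Finset.mul_sum]
      congr 1
      · rw [Fin.val_zero, pow_zero, Algebra.algebraMap_eq_smul_one]
      · refine Finset.sum_congr rfl fun k _ => ?_
        rw [← Algebra.smul_def, Fin.val_succ, pow_succ', mul_smul_comm]
    rw [← this]
    exact hT

theorem dense_genericPts (n : ℕ) : Dense (genericPts n) := by
  match n with
  | 0 => exact Dense.mono (fun u _ T _ => Subsingleton.elim _ _) dense_univ
  | 1 =>
    refine Dense.mono (fun u _ T _ => ?_) dense_univ
    have : nilBlock 1 = 0 := by simpa using nilBlock_pow_eq_zero (n := 1) (k := 1) le_rfl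
    simp [this]
  | n + 2 =>
    have h : Dense ((fun u : Pt (n + 2) => u (Fin.rev 1)) ⁻¹' {0}ᶜ) :=
      (dense_compl_singleton (0 : ℝ)).preimage (isOpenMap_eval _)
    exact h.mono fun u hu => mem_genericPts n u hu

theorem fieldU_comm_generic {u : Pt n} (hu : u ∈ genericPts n) {D : Pt n →ₗ[ℝ] Pt n}
    (h : ∀ v, D (fieldU n u *ᵥ v) = fieldU n u *ᵥ D v) (v : Pt n) :
    D (nilBlock n *ᵥ v) = nilBlock n *ᵥ D v := by
  have h1 := hu (LinearMap.toMatrix' D) (Matrix.ext_of_mulVec_single fun i => by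
    rw [← Matrix.mulVec_mulVec, ← Matrix.mulVec_mulVec, LinearMap.toMatrix'_mulVec,
      LinearMap.toMatrix'_mulVec, h])
  have h2 := congrArg (fun A => A *ᵥ v) h1
  simpa only [← Matrix.mulVec_mulVec, LinearMap.toMatrix'_mulVec] using h2

/-- The pairing `(a, w) ↦ (a w)₀` is given by the reversed dot product. -/
theorem fieldU_mulVec_zero (hn : 0 < n) (a w : Pt n) :
    (fieldU n a *ᵥ w) ⟨0, hn⟩ = ∑ j, a (Fin.rev j) * w j := by
  simp only [Matrix.mulVec, dotProduct, fieldU, Matrix.of_apply, Fin.le_def, Nat.zero_le, if_true,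
    Nat.sub_zero]

/-- The range of `N` is the maximal ideal, so a point minus its unit component is divisible by `N`.
-/
theorem exists_nilBlock_mulVec_eq {v : Pt n} (hn : 0 < n)
    (hv : v ⟨n - 1, Nat.sub_lt hn Nat.one_pos⟩ = 0) : ∃ w, nilBlock n *ᵥ w = v := by
  refine ⟨fun i => if h : 0 < (i : ℕ) then v ⟨i - 1, by omega⟩ else 0, ?_⟩
  ext i
  simp only [Matrix.mulVec, dotProduct, nilBlock_apply, ite_mul, one_mul, zero_mul]
  by_cases h : (i : ℕ) + 1 < n
  · rw [Finset.sum_eq_single ⟨(i : ℕ) + 1, h⟩]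
    · simp
    · intro b _ hb
      rw [if_neg]
      exact fun h' => hb (Fin.ext h')
    · simp
  · have : i = ⟨n - 1, Nat.sub_lt hn Nat.one_pos⟩ := Fin.ext (by simp only; omega)
    rw [Finset.sum_eq_zero, this, hv]
    intro b _
    rw [if_neg (by omega)]

/-! ### Taylor coefficients of `h(U)` and their derivatives -/

/-- The Taylor series at `0`. -/
def taylorSeries (f : ℝ → ℝ) : PowerSeries ℝ :=
  PowerSeries.mk fun k => iteratedDeriv k f 0 / (k.factorial : ℝ)

theorem taylorSeries_congr {f g : ℝ → ℝ} (h : f =ᶠ[𝓝 0] g) :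
    taylorSeries f = taylorSeries g := by
  ext k
  simp only [taylorSeries, PowerSeries.coeff_mk, h.iteratedDeriv_eq k]

theorem taylorSeries_const (c : ℝ) : taylorSeries (fun _ => c) = PowerSeries.C c := by
  ext k
  simp only [taylorSeries, PowerSeries.coeff_mk, iteratedDeriv_const, PowerSeries.coeff_C]
  split_ifs with h <;> simp [h]

theorem derivative_taylorSeries (f : ℝ → ℝ) :
    PowerSeries.derivative ℝ (taylorSeries f) = taylorSeries (deriv f) := by
  ext k
  simp only [PowerSeries.coeff_derivative, taylorSeries, PowerSeries.coeff_mk, iteratedDeriv_succ',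
    Nat.factorial_succ]
  push_cast
  field_simp

theorem taylorSeries_mul {f g : ℝ → ℝ} (hf : ContDiffAt ℝ ∞ f 0) (hg : ContDiffAt ℝ ∞ g 0) :
    taylorSeries (fun t => f t * g t) = taylorSeries f * taylorSeries g := by
  ext k
  have hk : ((k : ℕ∞) : WithTop ℕ∞) ≤ ∞ := by exact_mod_cast le_top
  rw [PowerSeries.coeff_mul, Finset.Nat.sum_antidiagonal_eq_sum_range_succ_mk]
  simp only [taylorSeries, PowerSeries.coeff_mk]
  rw [iteratedDeriv_fun_mul (hf.of_le hk) (hg.of_le hk), Finset.sum_div]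
  refine Finset.sum_congr rfl fun i hi => ?_
  have hi' : i ≤ k := by simpa [Nat.lt_succ_iff] using hi
  rw [Nat.cast_choose ℝ hi']
  have := Nat.factorial_ne_zero k
  field_simp

theorem taylorSeries_sum {ι : Type*} (s : Finset ι) {f : ι → ℝ → ℝ}
    (hf : ∀ i ∈ s, ContDiffAt ℝ ∞ (f i) 0) :
    taylorSeries (fun t => ∑ i ∈ s, f i t) = ∑ i ∈ s, taylorSeries (f i) := by
  ext k
  have hk : ((k : ℕ∞) : WithTop ℕ∞) ≤ ∞ := by exact_mod_cast le_top
  rw [map_sum]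
  simp only [taylorSeries, PowerSeries.coeff_mk]
  rw [iteratedDeriv_fun_sum fun i hi => (hf i hi).of_le hk, Finset.sum_div]

theorem taylorSeries_id : taylorSeries (fun t => t) = PowerSeries.X := by
  ext k
  rcases k with _ | k
  · simp [taylorSeries]
  · simp only [taylorSeries, PowerSeries.coeff_mk, iteratedDeriv_succ', deriv_id'',
      iteratedDeriv_const, PowerSeries.coeff_X]
    by_cases h : k = 0 <;> simp [h]

theorem taylorSeries_pow (j : ℕ) : taylorSeries (fun t => t ^ j) = PowerSeries.X ^ j := by
  induction j with
  | zero => simpa using taylorSeries_const 1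
  | succ j ih =>
    simp only [pow_succ]
    rw [taylorSeries_mul (by fun_prop) (by fun_prop), ih, taylorSeries_id]

theorem contDiff_curve (u : Pt n) : ContDiff ℝ ∞ (curve u) := by
  unfold curve
  fun_prop

/-- The power series `uⁿ + X uⁿ⁻¹ + … + Xⁿ⁻¹ u¹`. -/
def ptSeries (u : Pt n) : PowerSeries ℝ :=
  ∑ j : Fin n, PowerSeries.X ^ (j : ℕ) * PowerSeries.C (u (Fin.rev j))

theorem taylorSeries_curve (u : Pt n) : taylorSeries (curve u) = ptSeries u := by
  unfold curve ptSeries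
  rw [taylorSeries_sum _ fun j _ => by fun_prop]
  refine Finset.sum_congr rfl fun j _ => ?_
  rw [taylorSeries_mul (by fun_prop) (by fun_prop), taylorSeries_pow,
    taylorSeries_const]

theorem coeff_ptSeries (u : Pt n) (k : Fin n) :
    PowerSeries.coeff (k : ℕ) (ptSeries u) = u (Fin.rev k) := by
  simp only [ptSeries, map_sum, PowerSeries.coeff_mul_C, PowerSeries.coeff_X_pow, ite_mul, one_mul,
    zero_mul, Fin.val_inj]
  simp

theorem ptSeries_add_smul (u v : Pt n) (s : ℝ) :
    ptSeries (u + s • v) = ptSeries u + PowerSeries.C s * ptSeries v := by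
  simp only [ptSeries, Finset.mul_sum, ← Finset.sum_add_distrib]
  refine Finset.sum_congr rfl fun j _ => ?_
  simp only [Pi.add_apply, Pi.smul_apply, smul_eq_mul, map_add, map_mul]
  ring

theorem contDiff_coeff_ptSeries (k : ℕ) :
    ContDiff ℝ ∞ fun u : Pt n => PowerSeries.coeff k (ptSeries u) := by
  simp only [ptSeries, map_sum, PowerSeries.coeff_mul_C, PowerSeries.coeff_X_pow]
  fun_prop

/-- The truncation of a power series, as a point. -/
def toPt (n : ℕ) (p : PowerSeries ℝ) : Pt n := fun i => PowerSeries.coeff (Fin.rev i : ℕ) p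

theorem toPt_ptSeries (u : Pt n) : toPt n (ptSeries u) = u := by
  ext i
  rw [toPt, coeff_ptSeries, Fin.rev_rev]

/-- Truncation is a ring homomorphism from power series to the Toeplitz algebra; the matrix product
is the Cauchy product. -/
theorem fieldU_toPt_mulVec (p q : PowerSeries ℝ) :
    fieldU n (toPt n p) *ᵥ toPt n q = toPt n (p * q) := by
  ext i
  simp only [Matrix.mulVec, dotProduct, fieldU, Matrix.of_apply, toPt, Fin.rev_rev,
    PowerSeries.coeff_mul, ite_mul, zero_mul]
  rw [← Finset.sum_filter]
  refine Finset.sum_bij (fun j _ => ((j : ℕ) - i, (Fin.rev j : ℕ))) ?_ ?_ ?_ fun _ _ => rfl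
  · intro j hj
    have hj' : (i : ℕ) ≤ j := (Finset.mem_filter.1 hj).2
    simp only [Finset.HasAntidiagonal.mem_antidiagonal, Fin.val_rev]
    omega
  · intro j _ j' _ h
    exact Fin.rev_injective (Fin.ext (congrArg Prod.snd h))
  · rintro ⟨a, b⟩ hab
    have hab' : a + b = n - (i + 1) := by
      simpa only [Finset.HasAntidiagonal.mem_antidiagonal, Fin.val_rev] using hab
    refine ⟨⟨i + a, by omega⟩, ?_, ?_⟩
    · exact Finset.mem_filter.2 ⟨Finset.mem_univ _, Nat.le_add_right _ _⟩
    · simp only [Fin.val_rev, Prod.mk.injEq]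
      omega

theorem funU_eq (h : ℝ → ℝ) (u : Pt n) :
    funU n h u = fieldU n (toPt n (taylorSeries fun t => h (curve u t))) := by
  ext i j
  simp [funU, fieldU, toPt, taylorSeries, taylorCoeff]

theorem isOpen_slab (hn : 0 < n) {I : Set ℝ} (hI : IsOpen I) : IsOpen (slab hn I) :=
  hI.preimage (continuous_apply _)

theorem curve_zero (hn : 0 < n) (u : Pt n) :
    curve u 0 = u ⟨n - 1, Nat.sub_lt hn Nat.one_pos⟩ := by
  rw [curve, Finset.sum_eq_single ⟨0, hn⟩]
  · simp only [pow_zero, one_mul]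
    congr 1
  · intro b _ hb
    have : (b : ℕ) ≠ 0 := fun h => hb (Fin.ext h)
    simp [this]
  · simp

theorem derivative_taylorSeries_comp_curve (hn : 0 < n) {I : Set ℝ} (hI : IsOpen I) {h : ℝ → ℝ}
    (hh : ContDiffOn ℝ ∞ h I) {u : Pt n} (hu : u ∈ slab hn I) :
    PowerSeries.derivative ℝ (taylorSeries fun t => h (curve u t)) =
      (taylorSeries fun t => deriv h (curve u t)) * PowerSeries.derivative ℝ (ptSeries u) := by
  have hu' : curve u 0 ∈ I := by rwa [curve_zero hn]
  have hd : ContDiffOn ℝ ∞ (deriv h) I := ((contDiffOn_infty_iff_deriv_of_isOpen hI).1 hh).2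
  rw [derivative_taylorSeries, ← taylorSeries_curve, derivative_taylorSeries, ← taylorSeries_mul]
  · apply taylorSeries_congr
    have : ∀ᶠ t in 𝓝 (0 : ℝ), curve u t ∈ I :=
      (contDiff_curve u).continuous.continuousAt.preimage_mem_nhds (hI.mem_nhds hu')
    filter_upwards [this] with t ht
    exact deriv_comp t ((hh.contDiffAt (hI.mem_nhds ht)).differentiableAt (by simp))
      ((contDiff_curve u).differentiable (by simp) t)
  · exact (hd.contDiffAt (hI.mem_nhds hu')).comp 0 (contDiff_curve u).contDiffAt
  · exact (((contDiff_infty_iff_deriv).1 (contDiff_curve u)).2).contDiffAt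

/-- Coefficient comparison in the chain rule. Coefficients of `h` are reduced to lower ones of
`deriv h`, so smoothness and derivatives in `u` follow by strong induction over all `h`, without
interchanging derivatives in `t` and in `u`. -/
theorem taylorCoeff_succ (hn : 0 < n) {I : Set ℝ} (hI : IsOpen I) {h : ℝ → ℝ}
    (hh : ContDiffOn ℝ ∞ h I) {u : Pt n} (hu : u ∈ slab hn I) (k : ℕ) :
    taylorCoeff h u (k + 1) = (∑ p ∈ Finset.HasAntidiagonal.antidiagonal k,
      taylorCoeff (deriv h) u p.1 *
      (PowerSeries.coeff (p.2 + 1) (ptSeries u) * (p.2 + 1))) / (k + 1) := by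
  have := congrArg (PowerSeries.coeff k) (derivative_taylorSeries_comp_curve hn hI hh hu)
  rw [PowerSeries.coeff_derivative, PowerSeries.coeff_mul] at this
  simp only [PowerSeries.coeff_derivative, taylorSeries, PowerSeries.coeff_mk] at this
  rw [eq_div_iff (by positivity)]
  exact this

theorem contDiffOn_taylorCoeff (hn : 0 < n) {I : Set ℝ} (hI : IsOpen I) (k : ℕ) {h : ℝ → ℝ}
    (hh : ContDiffOn ℝ ∞ h I) :
    ContDiffOn ℝ ∞ (fun u : Pt n => taylorCoeff h u k) (slab hn I) := by
  induction k using Nat.strong_induction_on generalizing h with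
  | _ k ih =>
    rcases k with _ | k
    · have : (fun u : Pt n => taylorCoeff h u 0)
          = fun u => h (u ⟨n - 1, Nat.sub_lt hn Nat.one_pos⟩) := by
        ext u
        simp [taylorCoeff, curve_zero hn]
      rw [this]
      exact hh.comp (contDiff_apply ℝ ℝ _).contDiffOn fun u hu => hu
    · refine ContDiffOn.congr ?_ fun u hu => taylorCoeff_succ hn hI hh hu k
      refine (ContDiffOn.sum fun p hp => ?_).div_const _
      have hp' : p.1 < k + 1 := by
        have := Finset.HasAntidiagonal.mem_antidiagonal.1 hp
        omega
      exact (ih p.1 hp' ((contDiffOn_infty_iff_deriv_of_isOpen hI).1 hh).2).mul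
        ((contDiff_coeff_ptSeries _).mul contDiff_const).contDiffOn

theorem hasDerivAt_taylorCoeff (hn : 0 < n) {I : Set ℝ} (hI : IsOpen I) (k : ℕ) {h : ℝ → ℝ}
    (hh : ContDiffOn ℝ ∞ h I) {u : Pt n} (hu : u ∈ slab hn I) (v : Pt n) :
    HasDerivAt (fun s : ℝ => taylorCoeff h (u + s • v) k)
      (PowerSeries.coeff k ((taylorSeries fun t => deriv h (curve u t)) * ptSeries v)) 0 := by
  induction k using Nat.strong_induction_on generalizing h with
  | _ k ih =>
    have hd : ContDiffOn ℝ ∞ (deriv h) I := ((contDiffOn_infty_iff_deriv_of_isOpen hI).1 hh).2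
    rcases k with _ | k
    · have h1 : (fun s : ℝ => taylorCoeff h (u + s • v) 0)
          = fun s => h (u ⟨n - 1, Nat.sub_lt hn Nat.one_pos⟩
            + s * v ⟨n - 1, Nat.sub_lt hn Nat.one_pos⟩) := by
        ext s
        simp [taylorCoeff, curve_zero hn]
      have h2 : PowerSeries.coeff 0 ((taylorSeries fun t => deriv h (curve u t)) * ptSeries v)
          = deriv h (u ⟨n - 1, Nat.sub_lt hn Nat.one_pos⟩
            + 0 * v ⟨n - 1, Nat.sub_lt hn Nat.one_pos⟩)
            * (1 * v ⟨n - 1, Nat.sub_lt hn Nat.one_pos⟩) := by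
        have := coeff_ptSeries v ⟨0, hn⟩
        rw [PowerSeries.coeff_mul, Finset.Nat.antidiagonal_zero, Finset.sum_singleton, this]
        simp only [taylorSeries, PowerSeries.coeff_mk, iteratedDeriv_zero, curve_zero hn,
          Nat.factorial_zero, Nat.cast_one, div_one, zero_mul, add_zero, one_mul]
        congr 1
      rw [h1, h2]
      have hu' : u ⟨n - 1, Nat.sub_lt hn Nat.one_pos⟩
            + 0 * v ⟨n - 1, Nat.sub_lt hn Nat.one_pos⟩ ∈ I := by
        rw [zero_mul, add_zero]
        exact hu
      exact HasDerivAt.comp (h₂ := h) (0 : ℝ)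
        ((hh.contDiffAt (hI.mem_nhds hu')).differentiableAt (by simp)).hasDerivAt
        (((hasDerivAt_id' (0 : ℝ)).mul_const _).const_add _)
    · have hev : ∀ᶠ s in 𝓝 (0 : ℝ), u + s • v ∈ slab hn I := by
        have hc : Continuous fun s : ℝ => u + s • v := by fun_prop
        exact hc.continuousAt.preimage_mem_nhds ((isOpen_slab hn hI).mem_nhds (by simpa using hu))
      have hP (j : ℕ) : HasDerivAt
          (fun s : ℝ => PowerSeries.coeff (j + 1) (ptSeries (u + s • v)) * ((j : ℝ) + 1))
          (PowerSeries.coeff j (PowerSeries.derivative ℝ (ptSeries v))) 0 := by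
        simp only [ptSeries_add_smul, map_add, PowerSeries.coeff_C_mul,
          PowerSeries.coeff_derivative]
        simpa using (((hasDerivAt_id' (0 : ℝ)).mul_const
          (PowerSeries.coeff (j + 1) (ptSeries v))).const_add
          (PowerSeries.coeff (j + 1) (ptSeries u))).mul_const ((j : ℝ) + 1)
      have key : HasDerivAt (fun s : ℝ => (∑ p ∈ Finset.HasAntidiagonal.antidiagonal k,
          taylorCoeff (deriv h) (u + s • v) p.1 *
          (PowerSeries.coeff (p.2 + 1) (ptSeries (u + s • v)) * (p.2 + 1))) / (k + 1))
          (PowerSeries.coeff (k + 1) ((taylorSeries fun t => deriv h (curve u t)) * ptSeries v))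
          0 := by
        -- With `c`, `e` the series of `u`, `v`, this is `(h'(c) e)' = h''(c) c' e + h'(c) e'`,
        -- arranged to match the recursion differentiated term by term.
        have h1 : PowerSeries.coeff (k + 1)
            ((taylorSeries fun t => deriv h (curve u t)) * ptSeries v) =
            (∑ p ∈ Finset.HasAntidiagonal.antidiagonal k,
              (PowerSeries.coeff p.1
                ((taylorSeries fun t => deriv (deriv h) (curve u t)) * ptSeries v) *
                PowerSeries.coeff p.2 (PowerSeries.derivative ℝ (ptSeries u)) +
              PowerSeries.coeff p.1 (taylorSeries fun t => deriv h (curve u t)) *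
                PowerSeries.coeff p.2 (PowerSeries.derivative ℝ (ptSeries v)))) / (k + 1) := by
          rw [eq_div_iff (by positivity), ← PowerSeries.coeff_derivative, Finset.sum_add_distrib,
            ← PowerSeries.coeff_mul, ← PowerSeries.coeff_mul, ← map_add, Derivation.leibniz,
            derivative_taylorSeries_comp_curve hn hI hd hu, smul_eq_mul, smul_eq_mul]
          congr 1
          ring
        rw [h1]
        refine (HasDerivAt.fun_sum fun p hp => ?_).div_const _
        have hp' : p.1 < k + 1 := by
          have := Finset.HasAntidiagonal.mem_antidiagonal.1 hp
          omega
        refine ((ih p.1 hp' hd).fun_mul (hP p.2)).congr_deriv ?_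
        simp only [PowerSeries.coeff_derivative, taylorSeries, PowerSeries.coeff_mk, taylorCoeff,
          zero_smul, add_zero]
      refine key.congr_of_eventuallyEq ?_
      filter_upwards [hev] with s hs
      exact taylorCoeff_succ hn hI hh hs k

/-! ### Maps with Toeplitz-linear derivative -/

/-- The multiplication by a matrix, as a continuous linear map. -/
def mulCLM (A : Matrix (Fin n) (Fin n) ℝ) : Pt n →L[ℝ] Pt n :=
  LinearMap.toContinuousLinearMap A.mulVecLin

@[simp]
theorem mulCLM_apply (A : Matrix (Fin n) (Fin n) ℝ) (v : Pt n) : mulCLM A v = A *ᵥ v := rfl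

theorem fieldU_unitPt_mulVec (v : Pt n) : fieldU n (unitPt n) *ᵥ v = v := by
  rw [fieldU_mulVec_comm, fieldU_mulVec_unitPt]

theorem fieldU_nilBlock_mulVec_unitPt : fieldU n (nilBlock n *ᵥ unitPt n) = nilBlock n :=
  (eq_fieldU_of_commute rfl).symm

theorem fderiv_mulVec_comp (A : Matrix (Fin n) (Fin n) ℝ) {m : Pt n → Pt n} {u : Pt n}
    (hm : DifferentiableAt ℝ m u) (v : Pt n) :
    fderiv ℝ (fun y => A *ᵥ m y) u v = A *ᵥ fderiv ℝ m u v := by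
  have h := (mulCLM A).hasFDerivAt.comp u hm.hasFDerivAt
  exact congrArg (fun B : Pt n →L[ℝ] Pt n => B v) h.fderiv

/-- Smooth maps whose derivative is linear over the algebra of Toeplitz matrices. -/
structure IsHoloOn (V : Set (Pt n)) (m : Pt n → Pt n) : Prop where
  smooth : ContDiffOn ℝ ∞ m V
  commute : ∀ u ∈ V, ∀ v, fderiv ℝ m u (nilBlock n *ᵥ v) = nilBlock n *ᵥ fderiv ℝ m u v

namespace IsHoloOn

variable {V W : Set (Pt n)} {m m' : Pt n → Pt n}

theorem differentiableAt (h : IsHoloOn V m) (hV : IsOpen V) {u : Pt n} (hu : u ∈ V) :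
    DifferentiableAt ℝ m u :=
  (h.smooth.contDiffAt (hV.mem_nhds hu)).differentiableAt (by simp)

theorem mono (h : IsHoloOn V m) (hWV : W ⊆ V) : IsHoloOn W m :=
  ⟨h.smooth.mono hWV, fun u hu => h.commute u (hWV hu)⟩

theorem congr (h : IsHoloOn V m) (hV : IsOpen V) (hm : EqOn m' m V) : IsHoloOn V m' := by
  refine ⟨h.smooth.congr hm, fun u hu v => ?_⟩
  rw [(hm.eventuallyEq_of_mem (hV.mem_nhds hu)).fderiv_eq]
  exact h.commute u hu v

theorem fderiv_eq (h : IsHoloOn V m) {u : Pt n} (hu : u ∈ V) (v : Pt n) :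
    fderiv ℝ m u v = fieldU n v *ᵥ fderiv ℝ m u (unitPt n) :=
  map_eq_fieldU_of_commute (D := (fderiv ℝ m u : Pt n →ₗ[ℝ] Pt n)) (h.commute u hu) v

theorem sub (h : IsHoloOn V m) (h' : IsHoloOn V m') (hV : IsOpen V) :
    IsHoloOn V (fun u => m u - m' u) := by
  refine ⟨h.smooth.sub h'.smooth, fun u hu v => ?_⟩
  rw [fderiv_fun_sub (h.differentiableAt hV hu) (h'.differentiableAt hV hu)]
  simp only [sub_apply, h.commute u hu, h'.commute u hu, Matrix.mulVec_sub]

theorem sum {ι : Type*} {s : Finset ι} {m : ι → Pt n → Pt n} (h : ∀ i ∈ s, IsHoloOn V (m i))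
    (hV : IsOpen V) : IsHoloOn V (fun u => ∑ i ∈ s, m i u) := by
  refine ⟨ContDiffOn.sum fun i hi => (h i hi).smooth, fun u hu v => ?_⟩
  rw [fderiv_fun_sum fun i hi => (h i hi).differentiableAt hV hu]
  simp only [sum_apply, Matrix.mulVec_sum]
  exact Finset.sum_congr rfl fun i hi => (h i hi).commute u hu v

theorem mulVec_left (h : IsHoloOn V m) (hV : IsOpen V) {A : Matrix (Fin n) (Fin n) ℝ}
    (hA : A * nilBlock n = nilBlock n * A) : IsHoloOn V (fun u => A *ᵥ m u) := by
  refine ⟨(mulCLM A).contDiff.comp_contDiffOn h.smooth, fun u hu v => ?_⟩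
  rw [fderiv_mulVec_comp A (h.differentiableAt hV hu), fderiv_mulVec_comp A
    (h.differentiableAt hV hu), h.commute u hu, Matrix.mulVec_mulVec, Matrix.mulVec_mulVec, hA]

/-- By symmetry of the second derivative, `d²m(Nv, 1) = d²m(1, Nv) = N d²m(1, v)`. -/
theorem fderiv_unitPt (h : IsHoloOn V m) (hV : IsOpen V) :
    IsHoloOn V (fun u => fderiv ℝ m u (unitPt n)) := by
  have hs : ContDiffOn ℝ ∞ (fderiv ℝ m) V :=
    ((contDiffOn_infty_iff_fderiv_of_isOpen hV).1 h.smooth).2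
  refine ⟨hs.clm_apply contDiffOn_const, fun u hu v => ?_⟩
  have hd : DifferentiableAt ℝ (fderiv ℝ m) u :=
    (hs.contDiffAt (hV.mem_nhds hu)).differentiableAt (by simp)
  have hev (w v : Pt n) :
      fderiv ℝ (fun y => fderiv ℝ m y w) u v = fderiv ℝ (fderiv ℝ m) u v w := by
    rw [fderiv_clm_apply hd (differentiableAt_const w)]
    simp
  have hsymm : IsSymmSndFDerivAt ℝ m u :=
    (h.smooth.contDiffAt (hV.mem_nhds hu)).isSymmSndFDerivAt (by
      rw [minSmoothness_of_isRCLikeNormedField]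
      exact WithTop.coe_le_coe.2 le_top)
  rw [hev, hev, hsymm, hsymm v, ← hev, ← hev, ← fderiv_mulVec_comp]
  · have : (fun y => fderiv ℝ m y (nilBlock n *ᵥ v))
        =ᶠ[𝓝 u] fun y => nilBlock n *ᵥ fderiv ℝ m y v := by
      filter_upwards [hV.mem_nhds hu] with y hy using h.commute y hy v
    rw [this.fderiv_eq]
  · exact hd.clm_apply (differentiableAt_const v)

end IsHoloOn

/-! ### Rigidity: determination by the values on the unit line -/

theorem norm_smul_unitPt_lt {r s : ℝ} (hs : |s| < r) : ‖s • unitPt n‖ < r := by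
  rw [pi_norm_lt_iff ((abs_nonneg s).trans_lt hs)]
  intro i
  have : (s • unitPt n) i = if (i : ℕ) + 1 = n then s else 0 := by simp [unitPt]
  rw [this]
  split_ifs
  · exact hs
  · simpa using (abs_nonneg s).trans_lt hs

/-- A Toeplitz-linear differentiable map vanishing on the line spanned by the unit vanishes on
balls around the origin. -/
theorem IsHoloOn.eq_zero_of_line (hn : 0 < n) {r : ℝ} {m : Pt n → Pt n}
    (h : IsHoloOn (Metric.ball 0 r) m) (h0 : ∀ s : ℝ, |s| < r → m (s • unitPt n) = 0)
    {u : Pt n} (hu : u ∈ Metric.ball 0 r) : m u = 0 := by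
  -- Descending induction on `k`, starting from `Nⁿ = 0`. The map is quantified inside because the
  -- hypothesis for `k + 1` is applied to the derivative `dm(1)`, which also vanishes on the line.
  suffices H : ∀ j k, n ≤ k + j → ∀ m : Pt n → Pt n, IsHoloOn (Metric.ball 0 r) m →
      (∀ s : ℝ, |s| < r → m (s • unitPt n) = 0) →
      ∀ u ∈ Metric.ball (0 : Pt n) r, nilBlock n ^ k *ᵥ m u = 0 by
    simpa using H n 0 (by omega) m h h0 u hu
  have hO : IsOpen (Metric.ball (0 : Pt n) r) := Metric.isOpen_ball
  intro j
  induction j with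
  | zero =>
    intro k hk m _ _ u _
    rw [nilBlock_pow_eq_zero (by simpa using hk), Matrix.zero_mulVec]
  | succ j ih =>
    intro k hk m h h0 u hu
    have hline (s : ℝ) (hs : |s| < r) : s • unitPt n ∈ Metric.ball (0 : Pt n) r := by
      simpa using norm_smul_unitPt_lt hs
    have hd0 : ∀ s : ℝ, |s| < r → fderiv ℝ m (s • unitPt n) (unitPt n) = 0 := by
      intro s hs
      have h1 : HasDerivAt (fun s : ℝ => m (s • unitPt n))
          (fderiv ℝ m (s • unitPt n) ((1 : ℝ) • unitPt n)) s :=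
        (h.differentiableAt hO (hline s hs)).hasFDerivAt.comp_hasDerivAt s
          ((hasDerivAt_id' s).smul_const (unitPt n))
      have h2 : (fun s : ℝ => m (s • unitPt n)) =ᶠ[𝓝 s] fun _ => 0 := by
        filter_upwards [(continuous_abs.isOpen_preimage _ isOpen_Iio).mem_nhds hs] with x hx
          using h0 x hx
      have h3 := h1.unique ((hasDerivAt_const s (0 : Pt n)).congr_of_eventuallyEq h2)
      rwa [one_smul] at h3
    set c : ℝ := u ⟨n - 1, Nat.sub_lt hn Nat.one_pos⟩ with hc
    have hcr : |c| < r := (norm_le_pi_norm u _).trans_lt (by simpa using hu)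
    obtain ⟨w, hw⟩ : ∃ w, nilBlock n *ᵥ w = u - c • unitPt n := by
      apply exists_nilBlock_mulVec_eq hn
      have : n - 1 + 1 = n := by omega
      simp [unitPt, hc, this]
    -- Since `u - c·1 = Nw`, the derivative of `N^k m` along the segment from `c·1` to `u` is
    -- `w·N^(k+1) dm(1)`, which is zero by induction.
    have hz : ∀ y ∈ Metric.ball (0 : Pt n) r,
        nilBlock n ^ k *ᵥ fderiv ℝ m y (u - c • unitPt n) = 0 := by
      intro y hy
      have h1 := ih (k + 1) (by omega) _ (h.fderiv_unitPt hO) hd0 y hy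
      have h2 : nilBlock n ^ (k + 1) * fieldU n w = fieldU n w * nilBlock n ^ (k + 1) :=
        mul_fieldU_of_commute (by rw [← pow_succ, ← pow_succ']) w
      rw [← hw, h.commute y hy, h.fderiv_eq hy, Matrix.mulVec_mulVec, ← pow_succ,
        Matrix.mulVec_mulVec, h2, ← Matrix.mulVec_mulVec, h1, Matrix.mulVec_zero]
    have hseg : ∀ x ∈ Icc (0 : ℝ) 1,
        c • unitPt n + x • (u - c • unitPt n) ∈ Metric.ball (0 : Pt n) r := fun x hx =>
      (convex_ball (0 : Pt n) r).add_smul_sub_mem (hline c hcr) hu hx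
    have hder : ∀ x ∈ Icc (0 : ℝ) 1, HasDerivAt
        (fun x : ℝ => nilBlock n ^ k *ᵥ m (c • unitPt n + x • (u - c • unitPt n))) 0 x := by
      intro x hx
      have h1 : HasDerivAt (fun x : ℝ => c • unitPt n + x • (u - c • unitPt n))
          ((1 : ℝ) • (u - c • unitPt n)) x :=
        ((hasDerivAt_id' x).smul_const (u - c • unitPt n)).const_add _
      have h2 := (h.differentiableAt hO (hseg x hx)).hasFDerivAt.comp_hasDerivAt x h1
      have h3 := (mulCLM (nilBlock n ^ k)).hasFDerivAt.comp_hasDerivAt x h2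
      rw [one_smul, mulCLM_apply, hz _ (hseg x hx)] at h3
      exact h3
    have hfin := constant_of_has_deriv_right_zero
      (fun x hx => (hder x hx).continuousAt.continuousWithinAt)
      (fun x hx => (hder x (Ico_subset_Icc_self hx)).hasDerivWithinAt) 1
      (right_mem_Icc.2 zero_le_one)
    simpa [h0 c hcr] using hfin

theorem IsHoloOn.eq_of_line (hn : 0 < n) {r : ℝ} {m m' : Pt n → Pt n}
    (h : IsHoloOn (Metric.ball 0 r) m) (h' : IsHoloOn (Metric.ball 0 r) m')
    (h0 : ∀ s : ℝ, |s| < r → m (s • unitPt n) = m' (s • unitPt n))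
    {u : Pt n} (hu : u ∈ Metric.ball 0 r) : m u = m' u :=
  sub_eq_zero.1 ((h.sub h' Metric.isOpen_ball).eq_zero_of_line hn
    (fun s hs => sub_eq_zero.2 (h0 s hs)) hu)

/-! ### The maps `h(U)` and `symVec f` -/

/-- The derivative in direction `v` is the product of `v` with the truncated series of `deriv h`
along the curve, hence Toeplitz-linear. -/
theorem isHoloOn_taylorSeries (hn : 0 < n) {I : Set ℝ} (hI : IsOpen I) {h : ℝ → ℝ}
    (hh : ContDiffOn ℝ ∞ h I) :
    IsHoloOn (slab hn I) fun u => toPt n (taylorSeries fun t => h (curve u t)) := by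
  have hs : ContDiffOn ℝ ∞ (fun u => toPt n (taylorSeries fun t => h (curve u t)))
      (slab hn I) := by
    refine contDiffOn_pi.2 fun i => ?_
    refine (contDiffOn_taylorCoeff hn hI (Fin.rev i : ℕ) hh).congr fun u _ => ?_
    simp only [toPt, taylorSeries, PowerSeries.coeff_mk, taylorCoeff]
  refine ⟨hs, fun u hu v => ?_⟩
  have hd (v : Pt n) :
      fderiv ℝ (fun u => toPt n (taylorSeries fun t => h (curve u t))) u v =
        fieldU n (toPt n (taylorSeries fun t => deriv h (curve u t))) *ᵥ v := by
    have h1 : DifferentiableAt ℝ (fun u => toPt n (taylorSeries fun t => h (curve u t))) u :=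
      (hs.contDiffAt ((isOpen_slab hn hI).mem_nhds hu)).differentiableAt (by simp)
    have h2 : HasDerivAt
        (fun s : ℝ => toPt n (taylorSeries fun t => h (curve (u + s • v) t)))
        (toPt n ((taylorSeries fun t => deriv h (curve u t)) * ptSeries v)) 0 := by
      refine hasDerivAt_pi.2 fun i => ?_
      have := hasDerivAt_taylorCoeff hn hI (Fin.rev i : ℕ) hh hu v
      simpa only [toPt, taylorSeries, PowerSeries.coeff_mk, taylorCoeff] using this
    have h3 : HasLineDerivAt ℝ (fun u => toPt n (taylorSeries fun t => h (curve u t)))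
        (toPt n ((taylorSeries fun t => deriv h (curve u t)) * ptSeries v)) u v := h2
    rw [← h1.lineDeriv_eq_fderiv, h3.lineDeriv, ← fieldU_toPt_mulVec, toPt_ptSeries]
  rw [hd, hd, Matrix.mulVec_mulVec, Matrix.mulVec_mulVec, fieldU_mul_nilBlock]

/-- The point corresponding to the Toeplitz matrix `symField f u`. -/
def symVec (f : Fin n → ℝ → ℝ) (u : Pt n) : Pt n := symField f u *ᵥ unitPt n

theorem nilBlock_mul_symField (f : Fin n → ℝ → ℝ) (u : Pt n) :
    nilBlock n * symField f u = symField f u * nilBlock n := by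
  rw [symField, Finset.mul_sum, Finset.sum_mul]
  refine Finset.sum_congr rfl fun i _ => ?_
  rw [funU_eq, ← mul_assoc, ← fieldU_mul_nilBlock, mul_assoc, mul_assoc, ← pow_succ, ← pow_succ']

theorem symField_eq (f : Fin n → ℝ → ℝ) (u : Pt n) : symField f u = fieldU n (symVec f u) :=
  eq_fieldU_of_commute (nilBlock_mul_symField f u)

theorem symVec_eq (f : Fin n → ℝ → ℝ) (u : Pt n) :
    symVec f u = ∑ i : Fin n, nilBlock n ^ (n - 1 - (i : ℕ)) *ᵥ
      toPt n (taylorSeries fun t => f i (curve u t)) := by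
  rw [symVec, symField, Matrix.sum_mulVec]
  refine Finset.sum_congr rfl fun i _ => ?_
  rw [funU_eq, ← mul_fieldU_of_commute (by rw [← pow_succ, ← pow_succ']), ← Matrix.mulVec_mulVec,
    fieldU_mulVec_unitPt]

theorem isHoloOn_symVec (hn : 0 < n) {I : Set ℝ} (hI : IsOpen I) {f : Fin n → ℝ → ℝ}
    (hf : ∀ i, ContDiffOn ℝ ∞ (f i) I) : IsHoloOn (slab hn I) (symVec f) := by
  rw [show symVec f = _ from funext (symVec_eq f)]
  exact IsHoloOn.sum (fun i _ => (isHoloOn_taylorSeries hn hI (hf i)).mulVec_left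
    (isOpen_slab hn hI) (by rw [← pow_succ, ← pow_succ'])) (isOpen_slab hn hI)

theorem curve_smul_unitPt (hn : 0 < n) (s t : ℝ) : curve (s • unitPt n) t = s := by
  rw [curve, Finset.sum_eq_single ⟨0, hn⟩]
  · have : n - 1 + 1 = n := by omega
    simp [unitPt, this]
  · intro b _ hb
    have h1 : (b : ℕ) ≠ 0 := fun h => hb (Fin.ext h)
    have h2 : n - ((b : ℕ) + 1) + 1 ≠ n := by omega
    simp [unitPt, h2]
  · simp

/-- At `s·1` the curve is constantly `s`, so each `fᵢ(U)` is the scalar `fᵢ(s)`, and the powers of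
`N` applied to the unit are the standard basis vectors. -/
theorem symVec_smul_unitPt (hn : 0 < n) (f : Fin n → ℝ → ℝ) (s : ℝ) :
    symVec f (s • unitPt n) = fun i => f i s := by
  have h1 (c : ℝ) : toPt n (PowerSeries.C c) = c • unitPt n := by
    ext i
    simp only [toPt, PowerSeries.coeff_C, Fin.val_rev, Pi.smul_apply, unitPt, smul_eq_mul,
      mul_ite, mul_one, mul_zero]
    grind
  simp only [symVec_eq, curve_smul_unitPt hn, taylorSeries_const, h1, Matrix.mulVec_smul,
    nilBlock_pow_mulVec_unitPt]
  ext i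
  simp [Finset.sum_apply, Pi.single_apply]

/-! ### The bracket and the symmetries of `N` and `U` -/

theorem fderiv_app_apply {M : OpField n} {ξ : Pt n → Pt n} {u : Pt n}
    (hM : ∀ i j, DifferentiableAt ℝ (fun y => M y i j) u) (hξ : DifferentiableAt ℝ ξ u)
    (v : Pt n) (i : Fin n) :
    fderiv ℝ (M.app ξ) u v i =
      ∑ j, (M u i j * fderiv ℝ ξ u v j + ξ u j * fderiv ℝ (fun y => M y i j) u v) := by
  have h1 : HasFDerivAt (M.app ξ) (ContinuousLinearMap.pi fun i => ∑ j,
      (M u i j • (ContinuousLinearMap.proj j).comp (fderiv ℝ ξ u)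
        + ξ u j • fderiv ℝ (fun y => M y i j) u)) u := by
    refine hasFDerivAt_pi.2 fun i => ?_
    change HasFDerivAt (fun x => ∑ j, M x i j * ξ x j) _ u
    exact HasFDerivAt.fun_sum fun j _ =>
      (hM i j).hasFDerivAt.fun_mul (hasFDerivAt_pi'.1 hξ.hasFDerivAt j)
  rw [h1.fderiv]
  simp [sum_apply]

theorem fderiv_app {M : OpField n} {ξ : Pt n → Pt n} {u : Pt n}
    (hM : ∀ i j, DifferentiableAt ℝ (fun y => M y i j) u) (hξ : DifferentiableAt ℝ ξ u)
    (v : Pt n) :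
    fderiv ℝ (M.app ξ) u v =
      fderiv ℝ (fun y => M y *ᵥ ξ u) u v + M u *ᵥ fderiv ℝ ξ u v := by
  ext i
  have h : fderiv ℝ (fun y => M y *ᵥ ξ u) u v i = _ :=
    fderiv_app_apply (ξ := fun _ => ξ u) hM (differentiableAt_const (ξ u)) v i
  rw [fderiv_app_apply hM hξ, Pi.add_apply]
  rw [h, Matrix.mulVec, dotProduct, ← Finset.sum_add_distrib]
  refine Finset.sum_congr rfl fun j _ => ?_
  simp [add_comm]

/-- For commuting `L` and `M`, the value of `⟨L, M⟩(ξ, ξ)` at a point depends only on the value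
of `ξ` there. -/
theorem nijBracket_self_eq {L M : OpField n} {ξ : Pt n → Pt n} {u : Pt n}
    (hL : ∀ i j, DifferentiableAt ℝ (fun y => L y i j) u)
    (hM : ∀ i j, DifferentiableAt ℝ (fun y => M y i j) u) (hξ : DifferentiableAt ℝ ξ u)
    (hLM : L u * M u = M u * L u) :
    nijBracket L M ξ ξ u =
      L u *ᵥ fderiv ℝ (fun y => M y *ᵥ ξ u) u (ξ u)
        - M u *ᵥ fderiv ℝ (fun y => L y *ᵥ ξ u) u (ξ u)
        - fderiv ℝ (fun y => M y *ᵥ ξ u) u (L u *ᵥ ξ u)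
        + fderiv ℝ (fun y => L y *ᵥ ξ u) u (M u *ᵥ ξ u) := by
  -- All terms containing the derivative of `ξ` cancel; for `LM Dξ(ξ) - ML Dξ(ξ)` this uses
  -- commutativity.
  simp only [nijBracket, VectorField.lieBracket, fderiv_app hL hξ, fderiv_app hM hξ, sub_self,
    Matrix.mulVec_zero, Matrix.mulVec_sub, Matrix.mulVec_add, Matrix.mulVec_mulVec, hLM,
    OpField.app]
  abel

theorem contDiff_fieldU_apply (i j : Fin n) : ContDiff ℝ ∞ fun u => fieldU n u i j := by
  simp only [fieldU, Matrix.of_apply]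
  split_ifs
  · exact contDiff_apply ℝ ℝ _
  · exact contDiff_const

section Symmetry

variable {V : Set (Pt n)} {M : OpField n}

theorem OpField.SmoothOn.differentiableAt (hM : M.SmoothOn V) (hV : IsOpen V) {u : Pt n}
    (hu : u ∈ V) (i j : Fin n) : DifferentiableAt ℝ (fun y => M y i j) u :=
  ((hM i j).contDiffAt (hV.mem_nhds hu)).differentiableAt (by simp)

theorem OpField.SmoothOn.mulVec (hM : M.SmoothOn V) (x : Pt n) :
    ContDiffOn ℝ ∞ (fun u => M u *ᵥ x) V :=
  contDiffOn_pi.2 fun i => by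
    change ContDiffOn ℝ ∞ (fun u => ∑ j, M u i j * x j) V
    exact ContDiffOn.sum fun j _ => (hM i j).mul contDiffOn_const

theorem fderiv_mulVec_of_commute (hV : IsOpen V) (hM : M.SmoothOn V)
    (hc : ∀ u ∈ V, nilBlock n * M u = M u * nilBlock n) {u : Pt n} (hu : u ∈ V) (x v : Pt n) :
    fderiv ℝ (fun y => M y *ᵥ x) u v
      = fieldU n x *ᵥ fderiv ℝ (fun y => M y *ᵥ unitPt n) u v := by
  have h : (fun y => M y *ᵥ x) =ᶠ[𝓝 u] fun y => fieldU n x *ᵥ (M y *ᵥ unitPt n) := by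
    filter_upwards [hV.mem_nhds hu] with y hy
    conv_lhs => rw [eq_fieldU_of_commute (hc y hy)]
    rw [fieldU_mulVec_comm]
  rw [h.fderiv_eq, fderiv_mulVec_comp]
  exact ((hM.mulVec _).contDiffAt (hV.mem_nhds hu)).differentiableAt (by simp)

theorem nijBracket_fieldN (hV : IsOpen V) (hM : M.SmoothOn V)
    (hc : ∀ u ∈ V, nilBlock n * M u = M u * nilBlock n) {u : Pt n} (hu : u ∈ V)
    {ξ : Pt n → Pt n} (hξ : DifferentiableAt ℝ ξ u) :
    nijBracket (fieldN n) M ξ ξ u = fieldU n (ξ u) *ᵥ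
      (nilBlock n *ᵥ fderiv ℝ (fun y => M y *ᵥ unitPt n) u (ξ u)
        - fderiv ℝ (fun y => M y *ᵥ unitPt n) u (nilBlock n *ᵥ ξ u)) := by
  rw [nijBracket_self_eq (L := fieldN n) (fun _ _ => differentiableAt_const _)
    (hM.differentiableAt hV hu) hξ
    (hc u hu), fderiv_mulVec_of_commute hV hM hc hu (ξ u) (ξ u),
    fderiv_mulVec_of_commute hV hM hc hu (ξ u) (fieldN n u *ᵥ ξ u)]
  simp only [fieldN, fderiv_fun_const, Pi.zero_apply, zero_apply, Matrix.mulVec_zero, sub_zero,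
    add_zero, Matrix.mulVec_sub, Matrix.mulVec_mulVec, fieldU_mul_nilBlock]

theorem fderiv_fieldU_mulVec (u x v : Pt n) :
    fderiv ℝ (fun y => fieldU n y *ᵥ x) u v = fieldU n x *ᵥ v := by
  have h : (fun y => fieldU n y *ᵥ x) = fun y => fieldU n x *ᵥ y :=
    funext fun y => fieldU_mulVec_comm y x
  rw [h, fderiv_mulVec_comp _ differentiableAt_fun_id]
  simp

/-- As for `N`, except for two terms from the derivative of `U`, namely `ξ·(Mξ)` and `M(ξ·ξ)`; they
cancel because `M` is Toeplitz. -/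
theorem nijBracket_fieldU (hV : IsOpen V) (hM : M.SmoothOn V)
    (hc : ∀ u ∈ V, nilBlock n * M u = M u * nilBlock n) {u : Pt n} (hu : u ∈ V)
    {ξ : Pt n → Pt n} (hξ : DifferentiableAt ℝ ξ u) :
    nijBracket (fieldU n) M ξ ξ u = fieldU n (ξ u) *ᵥ
      (fieldU n u *ᵥ fderiv ℝ (fun y => M y *ᵥ unitPt n) u (ξ u)
        - fderiv ℝ (fun y => M y *ᵥ unitPt n) u (fieldU n u *ᵥ ξ u)) := by
  have hU (x : Pt n) : M u * fieldU n x = fieldU n x * M u :=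
    mul_fieldU_of_commute (hc u hu).symm x
  rw [nijBracket_self_eq
    (fun i j => ((contDiff_fieldU_apply i j).differentiable (by simp)).differentiableAt)
    (hM.differentiableAt hV hu) hξ (hU u).symm,
    fderiv_mulVec_of_commute hV hM hc hu (ξ u) (ξ u),
    fderiv_mulVec_of_commute hV hM hc hu (ξ u) (fieldU n u *ᵥ ξ u),
    fderiv_fieldU_mulVec, fderiv_fieldU_mulVec]
  simp only [Matrix.mulVec_sub, Matrix.mulVec_mulVec, hU, fieldU_comm u]
  abel

/-- Polarisation with the unit: first `E(1) = 0`, then `(x + 1)·E(x + 1) = x·E(x) + E(x)`. -/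
theorem eq_zero_of_fieldU_mulVec_self {E : Pt n →ₗ[ℝ] Pt n}
    (h : ∀ x, fieldU n x *ᵥ E x = 0) (x : Pt n) : E x = 0 := by
  have he : E (unitPt n) = 0 := by simpa only [fieldU_unitPt_mulVec] using h (unitPt n)
  have h1 := h (x + unitPt n)
  rw [map_add, he, add_zero, fieldU_add, Matrix.add_mulVec, h x, zero_add,
    fieldU_unitPt_mulVec] at h1
  exact h1

theorem commute_of_fieldU_mulVec_self {D : Pt n →L[ℝ] Pt n} {A : Matrix (Fin n) (Fin n) ℝ}
    (h : ∀ x, fieldU n x *ᵥ (A *ᵥ D x - D (A *ᵥ x)) = 0) (x : Pt n) :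
    D (A *ᵥ x) = A *ᵥ D x := by
  have := eq_zero_of_fieldU_mulVec_self
    (E := ((mulCLM A).comp D - D.comp (mulCLM A) : Pt n →L[ℝ] Pt n)) (by simpa using h) x
  exact (sub_eq_zero.1 (by simpa using this)).symm

theorem eqOn_of_eqOn_genericPts {Y : Type*} [TopologicalSpace Y] [T2Space Y] {f g : Pt n → Y}
    (hV : IsOpen V) (hf : ContinuousOn f V) (hg : ContinuousOn g V)
    (h : ∀ u ∈ V, u ∈ genericPts n → f u = g u) : EqOn f g V :=
  EqOn.of_subset_closure (s := V ∩ genericPts n) (fun u hu => h u hu.1 hu.2) hf hg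
    inter_subset_left ((dense_genericPts n).open_subset_closure_inter hV)

/-- Commuting of the derivative with `U` at every point of an open set amounts to commuting with
the Jordan block. -/
theorem isHoloOn_of_commute_fieldU (hV : IsOpen V) {m : Pt n → Pt n} (hm : ContDiffOn ℝ ∞ m V)
    (h : ∀ u ∈ V, ∀ v, fderiv ℝ m u (fieldU n u *ᵥ v) = fieldU n u *ᵥ fderiv ℝ m u v) :
    IsHoloOn V m := by
  have hc : ContinuousOn (fderiv ℝ m) V :=
    ((contDiffOn_infty_iff_fderiv_of_isOpen hV).1 hm).2.continuousOn
  refine ⟨hm, fun u hu v => ?_⟩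
  refine eqOn_of_eqOn_genericPts (f := fun u => fderiv ℝ m u (nilBlock n *ᵥ v))
    (g := fun u => nilBlock n *ᵥ fderiv ℝ m u v) hV (hc.clm_apply continuousOn_const)
    ((mulCLM (nilBlock n)).continuous.comp_continuousOn (hc.clm_apply continuousOn_const)) ?_ hu
  intro u hu hg
  exact fieldU_comm_generic hg (D := (fderiv ℝ m u : Pt n →ₗ[ℝ] Pt n)) (h u hu) v

theorem IsHoloOn.map_fieldU {m : Pt n → Pt n} (h : IsHoloOn V m) {u : Pt n} (hu : u ∈ V)
    (p v : Pt n) : fderiv ℝ m u (fieldU n p *ᵥ v) = fieldU n p *ᵥ fderiv ℝ m u v := by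
  rw [h.fderiv_eq hu, h.fderiv_eq hu v, fieldU_mulVec, Matrix.mulVec_mulVec]

theorem isSymmetryOn_fieldN_iff (hV : IsOpen V) :
    IsSymmetryOn V (fieldN n) M ↔ M.SmoothOn V ∧
      (∀ u ∈ V, nilBlock n * M u = M u * nilBlock n) ∧
      IsHoloOn V (fun u => M u *ᵥ unitPt n) := by
  constructor
  · rintro ⟨hs, hc, hb⟩
    refine ⟨hs, hc, hs.mulVec _, fun u hu => commute_of_fieldU_mulVec_self fun x => ?_⟩
    rw [← nijBracket_fieldN hV hs hc hu (ξ := fun _ => x) (differentiableAt_const x)]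
    exact hb _ contDiffOn_const u hu
  · rintro ⟨hs, hc, hh⟩
    refine ⟨hs, hc, fun ξ hξ u hu => ?_⟩
    rw [nijBracket_fieldN hV hs hc hu
      ((hξ.contDiffAt (hV.mem_nhds hu)).differentiableAt (by simp)), hh.commute u hu, sub_self,
      Matrix.mulVec_zero]

theorem isSymmetryOn_fieldU_iff (hV : IsOpen V) :
    IsSymmetryOn V (fieldU n) M ↔ M.SmoothOn V ∧
      (∀ u ∈ V, nilBlock n * M u = M u * nilBlock n) ∧
      IsHoloOn V (fun u => M u *ᵥ unitPt n) := by
  constructor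
  · rintro ⟨hs, hc, hb⟩
    have hcM : ContinuousOn M V :=
      continuousOn_pi.2 fun i => continuousOn_pi.2 fun j => (hs i j).continuousOn
    -- At generic points commuting with `U` forces commuting with `N`; continuity of `M` extends
    -- this to all of `V`.
    have hcN : ∀ u ∈ V, nilBlock n * M u = M u * nilBlock n := by
      refine eqOn_of_eqOn_genericPts hV (continuousOn_const.mul hcM) (hcM.mul continuousOn_const) ?_
      exact fun u hu hg => (hg (M u) (hc u hu).symm).symm
    refine ⟨hs, hcN, isHoloOn_of_commute_fieldU hV (hs.mulVec _) fun u hu =>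
      commute_of_fieldU_mulVec_self fun x => ?_⟩
    rw [← nijBracket_fieldU hV hs hcN hu (ξ := fun _ => x) (differentiableAt_const x)]
    exact hb _ contDiffOn_const u hu
  · rintro ⟨hs, hc, hh⟩
    refine ⟨hs, fun u hu => (mul_fieldU_of_commute (hc u hu).symm u).symm, fun ξ hξ u hu => ?_⟩
    rw [nijBracket_fieldU hV hs hc hu
      ((hξ.contDiffAt (hV.mem_nhds hu)).differentiableAt (by simp)), hh.map_fieldU hu, sub_self,
      Matrix.mulVec_zero]

end Symmetry

/-! ### Conservation laws of `N` and `U` -/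

section ConservationLaw

variable {V : Set (Pt n)} {θ : OneForm n}

/-- The identification of covectors with points through the pairing `(a, w) ↦ (a w)₀`. -/
def covecToPt (n : ℕ) : (Pt n →L[ℝ] ℝ) →L[ℝ] Pt n :=
  ContinuousLinearMap.pi fun i => ContinuousLinearMap.apply ℝ ℝ (Pi.single (Fin.rev i) 1)

theorem covec_apply_eq (hn : 0 < n) (φ : Pt n →L[ℝ] ℝ) (w : Pt n) :
    φ w = (fieldU n (covecToPt n φ) *ᵥ w) ⟨0, hn⟩ := by
  rw [fieldU_mulVec_zero]
  conv_lhs => rw [← Finset.univ_sum_single w]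
  rw [map_sum]
  refine Finset.sum_congr rfl fun j _ => ?_
  have : (Pi.single j (w j) : Pt n) = w j • Pi.single j 1 := by
    rw [← Pi.single_smul, smul_eq_mul, mul_one]
  rw [this, map_smul, smul_eq_mul, mul_comm]
  simp [covecToPt]

theorem eq_of_pairing_eq (hn : 0 < n) {a b : Pt n}
    (h : ∀ w, (fieldU n a *ᵥ w) ⟨0, hn⟩ = (fieldU n b *ᵥ w) ⟨0, hn⟩) : a = b := by
  ext i
  have := h (Pi.single (Fin.rev i) 1)
  simpa [fieldU_mulVec_zero, Pi.single_apply] using this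

/-- `(D(p·v)·w)₀ = (D(w)·p·v)₀ = (D(v)·p·w)₀` for all `w`, and the pairing is nondegenerate. -/
theorem commute_of_pairing_symm (hn : 0 < n) {D : Pt n → Pt n} {p : Pt n}
    (h1 : ∀ v w, (fieldU n (D v) *ᵥ w) ⟨0, hn⟩ = (fieldU n (D w) *ᵥ v) ⟨0, hn⟩)
    (h2 : ∀ v w, (fieldU n (D v) *ᵥ (fieldU n p *ᵥ w)) ⟨0, hn⟩
      = (fieldU n (D w) *ᵥ (fieldU n p *ᵥ v)) ⟨0, hn⟩) (v : Pt n) :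
    D (fieldU n p *ᵥ v) = fieldU n p *ᵥ D v := by
  refine eq_of_pairing_eq hn fun w => ?_
  rw [h1, ← h2, fieldU_mulVec, Matrix.mulVec_mulVec, fieldU_comm]

/-- Both sides are the coordinate of index `0` of the symmetric product `d·p·v·w`. -/
theorem pairing_symm (hn : 0 < n) {D : Pt n → Pt n} {d : Pt n}
    (h : ∀ v, D v = fieldU n v *ᵥ d) (p v w : Pt n) :
    (fieldU n (D v) *ᵥ (fieldU n p *ᵥ w)) ⟨0, hn⟩
      = (fieldU n (D w) *ᵥ (fieldU n p *ᵥ v)) ⟨0, hn⟩ := by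
  have key (x y : Pt n) : fieldU n (D x) *ᵥ (fieldU n p *ᵥ y)
      = fieldU n d *ᵥ (fieldU n p *ᵥ (fieldU n x *ᵥ y)) := by
    simp only [h, fieldU_mulVec, Matrix.mulVec_mulVec, fieldU_comm x, mul_assoc]
  rw [key, key, fieldU_mulVec_comm v w]

theorem fderiv_covecToPt {u : Pt n} (hθ : DifferentiableAt ℝ θ u) (v : Pt n) :
    fderiv ℝ (fun y => covecToPt n (θ y)) u v = covecToPt n (fderiv ℝ θ u v) :=
  congrArg (fun B : Pt n →L[ℝ] Pt n => B v)
    ((covecToPt n).hasFDerivAt.comp u hθ.hasFDerivAt).fderiv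

theorem fderiv_pull_fieldN {u : Pt n} (hθ : DifferentiableAt ℝ θ u) (v w : Pt n) :
    fderiv ℝ ((fieldN n).pull θ) u v w = fderiv ℝ θ u v (nilBlock n *ᵥ w) := by
  have h : HasFDerivAt ((fieldN n).pull θ) _ u :=
    hθ.hasFDerivAt.clm_comp (hasFDerivAt_const (mulCLM (nilBlock n)) u)
  rw [h.fderiv]
  simp [fieldN]

/-- Compared with a constant field there is an extra term `θ(v·w)`; being symmetric in `v` and `w`,
it drops out of `d(U^*θ)`. -/
theorem fderiv_pull_fieldU {u : Pt n} (hθ : DifferentiableAt ℝ θ u) (v w : Pt n) :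
    fderiv ℝ ((fieldU n).pull θ) u v w
      = fderiv ℝ θ u v (fieldU n u *ᵥ w) + θ u (fieldU n v *ᵥ w) := by
  let C : Pt n →ₗ[ℝ] (Pt n →L[ℝ] Pt n) :=
    { toFun := fun y => mulCLM (fieldU n y)
      map_add' := fun x y => by
        ext1 z
        simp [fieldU_add, Matrix.add_mulVec]
      map_smul' := fun c y => by
        ext1 z
        simp [fieldU_smul, Matrix.smul_mulVec] }
  have h : HasFDerivAt ((fieldU n).pull θ) _ u :=
    hθ.hasFDerivAt.clm_comp (LinearMap.toContinuousLinearMap C).hasFDerivAt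
  rw [h.fderiv]
  simp [C, add_comm]

theorem isConservationLawOn_fieldN_iff (hn : 0 < n) (hV : IsOpen V) :
    IsConservationLawOn V (fieldN n) θ ↔
      ContDiffOn ℝ ∞ θ V ∧ IsHoloOn V (fun u => covecToPt n (θ u)) := by
  have hd (hs : ContDiffOn ℝ ∞ θ V) {u : Pt n} (hu : u ∈ V) : DifferentiableAt ℝ θ u :=
    (hs.contDiffAt (hV.mem_nhds hu)).differentiableAt (by simp)
  constructor
  · rintro ⟨hs, hc, hp⟩
    refine ⟨hs, (covecToPt n).contDiff.comp_contDiffOn hs, fun u hu v => ?_⟩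
    rw [← fieldU_nilBlock_mulVec_unitPt]
    refine commute_of_pairing_symm hn (fun v w => ?_) (fun v w => ?_) v
    · rw [fderiv_covecToPt (hd hs hu), fderiv_covecToPt (hd hs hu), ← covec_apply_eq,
        ← covec_apply_eq]
      exact sub_eq_zero.1 (hc u hu v w)
    · rw [fderiv_covecToPt (hd hs hu), fderiv_covecToPt (hd hs hu), ← covec_apply_eq,
        ← covec_apply_eq, fieldU_nilBlock_mulVec_unitPt]
      have := sub_eq_zero.1 (hp u hu v w)
      rwa [fderiv_pull_fieldN (hd hs hu), fderiv_pull_fieldN (hd hs hu)] at this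
  · rintro ⟨hs, hh⟩
    have key {u : Pt n} (hu : u ∈ V) (p v w : Pt n) :
        fderiv ℝ θ u v (fieldU n p *ᵥ w) = fderiv ℝ θ u w (fieldU n p *ᵥ v) := by
      rw [covec_apply_eq hn, covec_apply_eq hn (fderiv ℝ θ u w), ← fderiv_covecToPt (hd hs hu),
        ← fderiv_covecToPt (hd hs hu)]
      exact pairing_symm hn (hh.fderiv_eq hu) p v w
    refine ⟨hs, fun u hu v w => sub_eq_zero.2 ?_, fun u hu v w => sub_eq_zero.2 ?_⟩
    · simpa only [fieldU_unitPt_mulVec] using key hu (unitPt n) v w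
    · rw [fderiv_pull_fieldN (hd hs hu), fderiv_pull_fieldN (hd hs hu),
        ← fieldU_nilBlock_mulVec_unitPt]
      exact key hu _ v w

theorem isConservationLawOn_fieldU_iff (hn : 0 < n) (hV : IsOpen V) :
    IsConservationLawOn V (fieldU n) θ ↔
      ContDiffOn ℝ ∞ θ V ∧ IsHoloOn V (fun u => covecToPt n (θ u)) := by
  have hd (hs : ContDiffOn ℝ ∞ θ V) {u : Pt n} (hu : u ∈ V) : DifferentiableAt ℝ θ u :=
    (hs.contDiffAt (hV.mem_nhds hu)).differentiableAt (by simp)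
  constructor
  · rintro ⟨hs, hc, hp⟩
    refine ⟨hs, isHoloOn_of_commute_fieldU hV ((covecToPt n).contDiff.comp_contDiffOn hs)
      fun u hu v => ?_⟩
    refine commute_of_pairing_symm hn (fun v w => ?_) (fun v w => ?_) v
    · rw [fderiv_covecToPt (hd hs hu), fderiv_covecToPt (hd hs hu), ← covec_apply_eq,
        ← covec_apply_eq]
      exact sub_eq_zero.1 (hc u hu v w)
    · rw [fderiv_covecToPt (hd hs hu), fderiv_covecToPt (hd hs hu), ← covec_apply_eq,
        ← covec_apply_eq]
      have := sub_eq_zero.1 (hp u hu v w)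
      rwa [fderiv_pull_fieldU (hd hs hu), fderiv_pull_fieldU (hd hs hu), fieldU_mulVec_comm v w,
        add_left_inj] at this
  · rintro ⟨hs, hh⟩
    have hN := (isConservationLawOn_fieldN_iff hn hV).2 ⟨hs, hh⟩
    refine ⟨hs, hN.closed, fun u hu v w => sub_eq_zero.2 ?_⟩
    rw [fderiv_pull_fieldU (hd hs hu), fderiv_pull_fieldU (hd hs hu), fieldU_mulVec_comm v w,
      add_left_inj, covec_apply_eq hn, covec_apply_eq hn (fderiv ℝ θ u w),
      ← fderiv_covecToPt (hd hs hu), ← fderiv_covecToPt (hd hs hu)]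
    exact pairing_symm hn (hh.fderiv_eq hu) u v w

theorem cornerFun_eq (hn : 0 < n) (f : Fin n → ℝ → ℝ) (u : Pt n) :
    cornerFun hn f u = symVec f u ⟨0, hn⟩ := by
  have h : unitPt n = Pi.single ⟨n - 1, Nat.sub_lt hn Nat.one_pos⟩ 1 := by
    ext i
    simp only [unitPt, Pi.single_apply, Fin.ext_iff]
    grind
  rw [cornerFun, symVec, h, Matrix.mulVec_single_one, Matrix.col_apply]

theorem fderiv_cornerFun (hn : 0 < n) {f : Fin n → ℝ → ℝ} {u : Pt n}
    (hu : DifferentiableAt ℝ (symVec f) u) (v : Pt n) :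
    fderiv ℝ (cornerFun hn f) u v = fderiv ℝ (symVec f) u v ⟨0, hn⟩ := by
  rw [show cornerFun hn f = _ from funext (cornerFun_eq hn f)]
  rw [(hasFDerivAt_pi'.1 hu.hasFDerivAt ⟨0, hn⟩).fderiv]
  rfl

/-- The corner entry is the coordinate of index `0` of `m = symVec f`, so its differential sends `w`
to `(dm(1)·w)₀`. -/
theorem covecToPt_fderiv_cornerFun (hn : 0 < n) {I : Set ℝ} (hI : IsOpen I) {f : Fin n → ℝ → ℝ}
    (hf : ∀ i, ContDiffOn ℝ ∞ (f i) I) {u : Pt n} (hu : u ∈ slab hn I) :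
    covecToPt n (fderiv ℝ (cornerFun hn f) u) = fderiv ℝ (symVec f) u (unitPt n) := by
  have hh := isHoloOn_symVec hn hI hf
  refine eq_of_pairing_eq hn fun w => ?_
  rw [← covec_apply_eq, fderiv_cornerFun hn (hh.differentiableAt (isOpen_slab hn hI) hu),
    hh.fderiv_eq hu, fieldU_mulVec_comm]

theorem isConservationLawOn_fderiv_cornerFun (hn : 0 < n) {I : Set ℝ} (hI : IsOpen I)
    {f : Fin n → ℝ → ℝ} (hf : ∀ i, ContDiffOn ℝ ∞ (f i) I) :
    IsConservationLawOn (slab hn I) (fieldU n) (fderiv ℝ (cornerFun hn f)) := by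
  have hO := isOpen_slab hn hI
  have hh := isHoloOn_symVec hn hI hf
  refine (isConservationLawOn_fieldU_iff hn hO).2 ⟨?_, ?_⟩
  · refine ((contDiffOn_infty_iff_fderiv_of_isOpen hO).1 ?_).2
    rw [show cornerFun hn f = _ from funext (cornerFun_eq hn f)]
    exact contDiffOn_pi.1 hh.smooth _
  · exact (hh.fderiv_unitPt hO).congr hO fun u hu => covecToPt_fderiv_cornerFun hn hI hf hu

end ConservationLaw

/-! ### Reconstruction from the unit line near the origin -/

theorem ball_subset_slab (hn : 0 < n) (r : ℝ) :
    Metric.ball (0 : Pt n) r ⊆ slab hn (Metric.ball 0 r) := by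
  intro u hu
  rw [mem_ball_zero_iff] at hu
  exact mem_ball_zero_iff.2 ((norm_le_pi_norm u _).trans_lt hu)

theorem IsHoloOn.contDiffOn_line {r : ℝ} {m : Pt n → Pt n}
    (h : IsHoloOn (Metric.ball 0 r) m) (i : Fin n) :
    ContDiffOn ℝ ∞ (fun s : ℝ => m (s • unitPt n) i) (Metric.ball 0 r) := by
  refine contDiffOn_pi.1 (h.smooth.comp (f := fun s : ℝ => s • unitPt n) ?_ ?_) i
  · exact (contDiff_id.smul contDiff_const).contDiffOn
  · intro s hs
    rw [mem_ball_zero_iff] at hs ⊢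
    exact norm_smul_unitPt_lt hs

theorem IsHoloOn.eq_symVec (hn : 0 < n) {r : ℝ} {m : Pt n → Pt n}
    (h : IsHoloOn (Metric.ball 0 r) m) {u : Pt n} (hu : u ∈ Metric.ball 0 r) :
    m u = symVec (fun i s => m (s • unitPt n) i) u :=
  h.eq_of_line hn ((isHoloOn_symVec hn Metric.isOpen_ball h.contDiffOn_line).mono
    (ball_subset_slab hn r))
    (fun s _ => (symVec_smul_unitPt hn (fun i s => m (s • unitPt n) i) s).symm) hu

theorem exists_antideriv_of_contDiffOn_ball {r : ℝ} {g : ℝ → ℝ}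
    (hg : ContDiffOn ℝ ∞ g (Metric.ball 0 r)) :
    ∃ f : ℝ → ℝ, ContDiffOn ℝ ∞ f (Metric.ball 0 r) ∧
      ∀ s ∈ Metric.ball (0 : ℝ) r, HasDerivAt f (g s) s := by
  have hd : ∀ s ∈ Metric.ball (0 : ℝ) r, HasDerivAt (fun t => ∫ x in (0 : ℝ)..t, g x) (g s) s := by
    intro s hs
    have h0 : (0 : ℝ) ∈ Metric.ball (0 : ℝ) r :=
      Metric.mem_ball_self (Metric.pos_of_mem_ball hs)
    have hsub : uIcc 0 s ⊆ Metric.ball (0 : ℝ) r := by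
      rw [← segment_eq_uIcc]
      exact (convex_ball (0 : ℝ) r).segment_subset h0 hs
    exact intervalIntegral.integral_hasDerivAt_right
      (hg.continuousOn.mono hsub).intervalIntegrable
      (hg.continuousOn.stronglyMeasurableAtFilter Metric.isOpen_ball s hs)
      (hg.continuousOn.continuousAt (Metric.isOpen_ball.mem_nhds hs))
  refine ⟨_, (contDiffOn_infty_iff_deriv_of_isOpen Metric.isOpen_ball).2
    ⟨fun s hs => (hd s hs).differentiableAt.differentiableWithinAt,
      hg.congr fun s hs => (hd s hs).deriv⟩, hd⟩

/-- Near the origin, every Toeplitz-linear differentiable map has a primitive `symVec f`. -/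
theorem IsHoloOn.exists_eq_fderiv_symVec (hn : 0 < n) {r : ℝ} {a : Pt n → Pt n}
    (h : IsHoloOn (Metric.ball 0 r) a) :
    ∃ f : Fin n → ℝ → ℝ, (∀ i, ContDiffOn ℝ ∞ (f i) (Metric.ball 0 r)) ∧
      ∀ u ∈ Metric.ball 0 r, a u = fderiv ℝ (symVec f) u (unitPt n) := by
  -- The `fᵢ` are primitives of the coordinates of `a` on the unit line. There the derivative of
  -- `symVec f` along the unit is `a`, and rigidity carries the equality to the ball.
  choose f hf hfd using fun i => exists_antideriv_of_contDiffOn_ball (h.contDiffOn_line i)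
  have hO := isOpen_slab hn (Metric.isOpen_ball (x := (0 : ℝ)) (ε := r))
  have hh := isHoloOn_symVec hn Metric.isOpen_ball hf
  refine ⟨f, hf, fun u hu => h.eq_of_line hn ((hh.fderiv_unitPt hO).mono (ball_subset_slab hn r))
    (fun s hs => ?_) hu⟩
  have hmem : s • unitPt n ∈ slab hn (Metric.ball 0 r) :=
    ball_subset_slab hn r (mem_ball_zero_iff.2 (norm_smul_unitPt_lt hs))
  have h1 : HasDerivAt (fun s : ℝ => symVec f (s • unitPt n))
      (fderiv ℝ (symVec f) (s • unitPt n) ((1 : ℝ) • unitPt n)) s :=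
    HasFDerivAt.comp_hasDerivAt (l := symVec f) s (hh.differentiableAt hO hmem).hasFDerivAt
      ((hasDerivAt_id' s).smul_const (unitPt n))
  have h2 : HasDerivAt (fun s : ℝ => symVec f (s • unitPt n)) (a (s • unitPt n)) s := by
    rw [show (fun s : ℝ => symVec f (s • unitPt n)) = _ from funext (symVec_smul_unitPt hn f)]
    exact hasDerivAt_pi.2 fun i => hfd i s (mem_ball_zero_iff.2 hs)
  rw [h2.unique h1, one_smul]

theorem isSymmetryOn_symField (hn : 0 < n) {I : Set ℝ} (hI : IsOpen I) {f : Fin n → ℝ → ℝ}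
    (hf : ∀ i, ContDiffOn ℝ ∞ (f i) I) :
    IsSymmetryOn (slab hn I) (fieldU n) (symField f) := by
  have hh := isHoloOn_symVec hn hI hf
  refine (isSymmetryOn_fieldU_iff (isOpen_slab hn hI)).2
    ⟨fun i j => ?_, fun u _ => nilBlock_mul_symField f u, hh⟩
  simp only [symField_eq]
  exact (contDiff_fieldU_apply i j).comp_contDiffOn hh.smooth

end ToeplitzJordan

end

theorem theorem1p4 (n : ℕ) (hn : 0 < n) :
    -- `U` and `N` have the same symmetries
    (∀ V : Set (ToeplitzJordan.Pt n), IsOpen V → ∀ M : ToeplitzJordan.OpField n,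
      (ToeplitzJordan.IsSymmetryOn V (ToeplitzJordan.fieldU n) M ↔
        ToeplitzJordan.IsSymmetryOn V (ToeplitzJordan.fieldN n) M)) ∧
    -- arbitrary smooth functions near `0` give a symmetry
    (∀ (I : Set ℝ) (f : Fin n → ℝ → ℝ), IsOpen I → (0 : ℝ) ∈ I →
      (∀ i, ContDiffOn ℝ ∞ (f i) I) →
      ToeplitzJordan.IsSymmetryOn (ToeplitzJordan.slab hn I) (ToeplitzJordan.fieldU n)
        (ToeplitzJordan.symField f)) ∧
    -- every symmetry is obtained near the origin in this way
    (∀ V : Set (ToeplitzJordan.Pt n), IsOpen V → 0 ∈ V → ∀ M : ToeplitzJordan.OpField n,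
      ToeplitzJordan.IsSymmetryOn V (ToeplitzJordan.fieldU n) M →
      ∃ (I : Set ℝ) (f : Fin n → ℝ → ℝ) (W : Set (ToeplitzJordan.Pt n)),
        IsOpen I ∧ (0 : ℝ) ∈ I ∧ (∀ i, ContDiffOn ℝ ∞ (f i) I) ∧
        IsOpen W ∧ 0 ∈ W ∧ W ⊆ V ∩ ToeplitzJordan.slab hn I ∧
        ∀ u ∈ W, M u = ToeplitzJordan.symField f u) ∧
    -- the symmetry determines the functions near `0`
    (∀ (I : Set ℝ) (f g : Fin n → ℝ → ℝ), IsOpen I → (0 : ℝ) ∈ I →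
      (∀ i, ContDiffOn ℝ ∞ (f i) I) → (∀ i, ContDiffOn ℝ ∞ (g i) I) →
      (∀ᶠ u in 𝓝 (0 : ToeplitzJordan.Pt n),
        ToeplitzJordan.symField f u = ToeplitzJordan.symField g u) →
      ∀ i, ∀ᶠ t in 𝓝 (0 : ℝ), f i t = g i t) ∧
    -- `U` and `N` have the same conservation laws
    (∀ V : Set (ToeplitzJordan.Pt n), IsOpen V → ∀ θ : ToeplitzJordan.OneForm n,
      (ToeplitzJordan.IsConservationLawOn V (ToeplitzJordan.fieldU n) θ ↔
        ToeplitzJordan.IsConservationLawOn V (ToeplitzJordan.fieldN n) θ)) ∧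
    -- the differential of the upper right entry is a conservation law
    (∀ (I : Set ℝ) (f : Fin n → ℝ → ℝ), IsOpen I → (0 : ℝ) ∈ I →
      (∀ i, ContDiffOn ℝ ∞ (f i) I) →
      ToeplitzJordan.IsConservationLawOn (ToeplitzJordan.slab hn I) (ToeplitzJordan.fieldU n)
        (fderiv ℝ (ToeplitzJordan.cornerFun hn f))) ∧
    -- every conservation law is obtained near the origin in this way
    (∀ V : Set (ToeplitzJordan.Pt n), IsOpen V → 0 ∈ V → ∀ θ : ToeplitzJordan.OneForm n,
      ToeplitzJordan.IsConservationLawOn V (ToeplitzJordan.fieldU n) θ →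
      ∃ (I : Set ℝ) (f : Fin n → ℝ → ℝ) (W : Set (ToeplitzJordan.Pt n)),
        IsOpen I ∧ (0 : ℝ) ∈ I ∧ (∀ i, ContDiffOn ℝ ∞ (f i) I) ∧
        IsOpen W ∧ 0 ∈ W ∧ W ⊆ V ∩ ToeplitzJordan.slab hn I ∧
        ∀ u ∈ W, θ u = fderiv ℝ (ToeplitzJordan.cornerFun hn f) u) := by
  open ToeplitzJordan in
  refine ⟨fun V hV M => ?_, fun I f hI _ hf => isSymmetryOn_symField hn hI hf,
    fun V hV h0 M hM => ?_, fun I f g _ _ _ _ hfg i => ?_, fun V hV θ => ?_,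
    fun I f hI _ hf => isConservationLawOn_fderiv_cornerFun hn hI hf, fun V hV h0 θ hθ => ?_⟩
  · rw [isSymmetryOn_fieldU_iff hV, isSymmetryOn_fieldN_iff hV]
  · obtain ⟨-, hc, hh⟩ := (isSymmetryOn_fieldU_iff hV).1 hM
    obtain ⟨r, hr, hrV⟩ := Metric.isOpen_iff.1 hV 0 h0
    have hb := hh.mono hrV
    -- The functions left to unification are the coordinates of `M(s·1) 1`, the restriction of the
    -- holomorphic map to the unit line.
    refine ⟨Metric.ball 0 r, _, Metric.ball 0 r, Metric.isOpen_ball, Metric.mem_ball_self hr,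
      hb.contDiffOn_line, Metric.isOpen_ball, Metric.mem_ball_self hr,
      subset_inter hrV (ball_subset_slab hn r), fun u hu => ?_⟩
    rw [symField_eq, ← hb.eq_symVec hn hu]
    exact eq_fieldU_of_commute (hc u (hrV hu))
  -- Uniqueness of the germs: on the unit line, which passes through the origin, the coordinates of
  -- `symVec f` are the `fᵢ`.
  · have ht : Tendsto (fun s : ℝ => s • unitPt n) (𝓝 0) (𝓝 0) := by
      have hc : Continuous fun s : ℝ => s • unitPt n := by fun_prop
      simpa using hc.tendsto 0
    filter_upwards [ht.eventually hfg] with s hs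
    have h1 : symVec f (s • unitPt n) = symVec g (s • unitPt n) := by rw [symVec, symVec, hs]
    rw [symVec_smul_unitPt hn, symVec_smul_unitPt hn] at h1
    exact congrFun h1 i
  · rw [isConservationLawOn_fieldU_iff hn hV, isConservationLawOn_fieldN_iff hn hV]
  · obtain ⟨-, hh⟩ := (isConservationLawOn_fieldU_iff hn hV).1 hθ
    obtain ⟨r, hr, hrV⟩ := Metric.isOpen_iff.1 hV 0 h0
    obtain ⟨f, hf, hfa⟩ := (hh.mono hrV).exists_eq_fderiv_symVec hn
    refine ⟨Metric.ball 0 r, f, Metric.ball 0 r, Metric.isOpen_ball, Metric.mem_ball_self hr,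
      hf, Metric.isOpen_ball, Metric.mem_ball_self hr,
      subset_inter hrV (ball_subset_slab hn r), fun u hu => ?_⟩
    ext1 w
    rw [covec_apply_eq hn, covec_apply_eq hn (fderiv ℝ _ u), hfa u hu,
      covecToPt_fderiv_cornerFun hn Metric.isOpen_ball hf (ball_subset_slab hn r hu)]
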